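/- Let $P\subset\mathbb R^2$ be a (non-degenerate) triangle with perimeter $L$, and parametrize $\partial P$ by arc length $s\in[0,L]$, starting at a vertex. The slap map $\psi_P\colon[0,L]\to[0,L]$ sends each $s$ that is not a vertex to the parameter $s'$ of the closest point of $\partial P$, other than the starting point, on the ray that starts at the point of parameter $s$, is orthogonal to $\partial P$ there and is directed inside $P$; its values at the vertices, where there is no normal, are immaterial. An acip of $\psi_P$ is a $\psi_P$-invariant Borel probability measure on $[0,L]$ that is absolutely continuous with respect to Lebesgue measure. An acip $\mu$ has $k\ge 1$ mixing components if its support is a disjoint union of $k$ measurable sets of positive $\mu$-measure that are cyclically permuted by $\psi_P$ (up to $\mu$-null sets) and on each of which $\psi_P^k$, with the normalized restriction of $\mu$, is exact. Then $\psi_P$ has exactly one ergodic acip $\mu$. If $P$ is acute, then $\mu$ is mixing and its support is the whole interval $[0,L]$. If $P$ is not acute (right or obtuse), then $\mu$ has a finite number of mixing components, and this number is even. -/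

import Mathlib

open MeasureTheory Filter Topology Set

noncomputable section

/-! ### Invariant measures of a transformation -/

section Ergodic

variable {X : Type*}

/-- `μ` is an *acip* of `f`: an `f`-invariant probability measure, absolutely continuous with
respect to the reference measure `m` (for an interval, Lebesgue measure). -/
structure IsAcip [MeasurableSpace X] (m : Measure X) (f : X → X) (μ : Measure X) : Prop where
  isProbabilityMeasure : IsProbabilityMeasure μ
  absolutelyContinuous : μ ≪ m
  measurePreserving : MeasurePreserving f μ μ

/-- (Strong) mixing: `μ (f⁻ⁿ A ∩ B) → μ A * μ B` for all measurable sets `A`, `B`. -/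
structure IsMixing [MeasurableSpace X] (f : X → X) (μ : Measure X) : Prop where
  measurePreserving : MeasurePreserving f μ μ
  tendsto : ∀ A B : Set X, MeasurableSet A → MeasurableSet B →
    Tendsto (fun n : ℕ => μ ((f^[n]) ⁻¹' A ∩ B)) atTop (𝓝 (μ A * μ B))

/-- Exactness: every set of the tail σ-algebra `⋂ n, f⁻ⁿ 𝓑` is null or conull. -/
structure IsExactMeasure [mX : MeasurableSpace X] (f : X → X) (μ : Measure X) : Prop where
  measurePreserving : MeasurePreserving f μ μ
  tail_trivial : ∀ A : Set X, (∀ n : ℕ, MeasurableSet[mX.comap (f^[n])] A) →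
    μ A = 0 ∨ μ Aᶜ = 0

/-- `(f, μ)` has exactly `k` mixing components: the support of `μ` is the disjoint union of `k`
measurable sets of positive measure that are cyclically permuted by `f` (up to `μ`-null sets), and
`f^k`, with the normalized restriction of `μ`, is exact on each of them. -/
def HasMixingComponents [TopologicalSpace X] [MeasurableSpace X] (f : X → X) (μ : Measure X)
    (k : ℕ) : Prop :=
  ∃ S : Fin k → Set X,
    (∀ j, MeasurableSet (S j)) ∧
    (∀ j, μ (S j) ≠ 0) ∧
    (∀ i j, i ≠ j → Disjoint (S i) (S j)) ∧
    (⋃ j, S j) = μ.support ∧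
    (∀ j, f ⁻¹' S (finRotate k j) =ᵐ[μ] S j) ∧
    ∀ j, IsExactMeasure (f^[k]) (ProbabilityTheory.cond μ (S j))

end Ergodic

/-! ### The slap map of a triangle -/

/-- The Euclidean plane. -/
abbrev Plane : Type := EuclideanSpace ℝ (Fin 2)

namespace Slap

/-- Length of the side joining the vertices `i` and `i + 1` (cyclically). -/
def sideLength (T : Affine.Triangle ℝ Plane) (i : Fin 3) : ℝ :=
  dist (T.points i) (T.points (i + 1))

/-- Arc length parameter of the vertex `i`, measured along the boundary from the vertex `0`. -/
def sideStart (T : Affine.Triangle ℝ Plane) (i : Fin 3) : ℝ :=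
  ∑ j ∈ Finset.Iio i, sideLength T j

/-- The perimeter `L`. -/
def perimeter (T : Affine.Triangle ℝ Plane) : ℝ := ∑ i, sideLength T i

/-- The interval `[0, L]` of arc length parameters. -/
abbrev Param (T : Affine.Triangle ℝ Plane) : Type := Set.Icc (0 : ℝ) (perimeter T)

/-- Lebesgue measure on `[0, L]`. -/
def lebesgue (T : Affine.Triangle ℝ Plane) : Measure (Param T) :=
  (volume : Measure ℝ).comap Subtype.val

/-- The point of the side `i` at distance `t` from the vertex `i`. -/
def sidePoint (T : Affine.Triangle ℝ Plane) (i : Fin 3) (t : ℝ) : Plane :=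
  AffineMap.lineMap (T.points i) (T.points (i + 1)) (t / sideLength T i)

/-- The arc length parametrization of the boundary, running through the sides `0`, `1`, `2`. -/
def boundaryPoint (T : Affine.Triangle ℝ Plane) (s : ℝ) : Plane :=
  if s ≤ sideStart T 1 then sidePoint T 0 s
  else if s ≤ sideStart T 2 then sidePoint T 1 (s - sideStart T 1)
  else sidePoint T 2 (s - sideStart T 2)

/-- The (open) ray issuing from a point `x` of the side `i`, orthogonal to that side and directed
inside the triangle, that is, towards the opposite vertex `i + 2` (in the plane, this leaves
one of the two directions of the normal line). -/
def inwardRay (T : Affine.Triangle ℝ Plane) (i : Fin 3) (x : Plane) : Set Plane :=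
  {y | inner ℝ (y - x) (T.points (i + 1) - T.points i) = 0 ∧
       0 < inner ℝ (y - x) (T.points (i + 2) - T.points i)}

/-- `s` lies in the interior of a side, and `s'` is a parameter of the point closest to the point
of parameter `s` among the boundary points on the inward normal ray at `s`. -/
def SlapsTo (T : Affine.Triangle ℝ Plane) (s s' : Param T) : Prop :=
  ∃ i : Fin 3, (s : ℝ) ∈ Set.Ioo (sideStart T i) (sideStart T i + sideLength T i) ∧
    boundaryPoint T s' ∈ inwardRay T i (boundaryPoint T s) ∧
    ∀ r : Param T, boundaryPoint T r ∈ inwardRay T i (boundaryPoint T s) →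
      dist (boundaryPoint T s) (boundaryPoint T s') ≤ dist (boundaryPoint T s) (boundaryPoint T r)

open Classical in
/-- The slap map `ψ : [0, L] → [0, L]`. At the four parameters `s` of vertices, where there is no
normal, it is given the value `s`; at the at most one `s` whose image is the vertex with the two
parameters `0` and `L`, one of these is chosen. This finite set of values does not affect acips. -/
def slapMap (T : Affine.Triangle ℝ Plane) (s : Param T) : Param T :=
  if h : ∃ s', SlapsTo T s s' then h.choose else s

end Slap

end

/-! ### Invariant measures as limits of averages. -/

section InvariantMeasure

open scoped ENNReal

/-! On each side the foot of the altitude separates two branches of the slap map. On each branch the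
map is affine with slope `-1 / cos` of the angle at the nearer end of the side, so it is a piecewise
affine map whose slopes all exceed some `Λ > 1` in modulus. The dynamical part of the argument uses
only this normal form, `IsTriangleSlap`; `Slap.isTriangleSlap` derives it from the geometry.

Existence. Finite sums of weighted Lebesgue measures on intervals are stable under push-forward, and
their total weight `V` satisfies a Lasota–Yorke inequality
(`PiecewiseExpanding.exists_lasotaYorke`). For an iterate with `Λ ^ N > 4` the inequality contracts
`V`, so all images of Lebesgue measure are dominated by one multiple of it, and Cesàro averages
yield an acip with bounded density (`exists_invariant_of_map_iterate_le`).

Cells. Pushing a short interval around a density point of `A` forward, with `V` controlled, leaves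
at least half of its mass on intervals of definite length. Hence there are finitely many cells such
that the forward images of any set of positive measure almost fill one of them (`IsCellFamily`).

Spreading. An interval grows under iteration until it contains the foot of an altitude in its
interior (`IsTriangleSlap.exists_reach_foot`). In the acute case it then spreads over all of `[0,
L]`; otherwise only one foot is interior to its side, so any two intervals have overlapping images.
Either way two disjoint invariant sets cannot both have positive measure, which makes Lebesgue
measure ergodic and the acip unique.

Finer properties. In the acute case a tail set almost fills a cell and then everything, so the tail
is trivial; mixing follows by a Hilbert space argument, and full support by spreading. In general
the cells bound the measures of nonnull tail sets from below, so the tail σ-algebra has an atom,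
whose preimages are the cyclically permuted exact components. If an angle is not acute, the opposite
side and the union of the other two sides are exchanged; this two-periodicity forces the number of
components to be even. -/

/-- A finitely additive set function dominated by a finite measure is a measure. -/
theorem exists_measure_of_additive_le {X : Type*} [MeasurableSpace X] (m : Measure X)
    [IsFiniteMeasure m] (φ : Set X → ℝ≥0∞)
    (hadd : ∀ A B, MeasurableSet A → MeasurableSet B → Disjoint A B → φ (A ∪ B) = φ A + φ B)
    (hle : ∀ A, MeasurableSet A → φ A ≤ m A) :
    ∃ μ : Measure X, ∀ A, MeasurableSet A → μ A = φ A := by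
  have h0 : φ ∅ = 0 := by simpa using hle ∅ MeasurableSet.empty
  refine ⟨Measure.ofMeasurable (fun A _ => φ A) h0 ?_, fun A hA => Measure.ofMeasurable_apply A hA⟩
  intro f hf hd
  -- Only finite additivity is available: split off `k` sets, and let domination by `m` make the
  -- remainder vanish as a tail of a convergent series.
  have hsplit : ∀ k, φ (⋃ i, f i) = ∑ i ∈ Finset.range k, φ (f i) + φ (⋃ i, f (i + k)) := by
    intro k
    induction k with
    | zero => simp
    | succ k ih =>
      have hU : (⋃ i, f (i + k)) = f k ∪ ⋃ i, f (i + (k + 1)) := by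
        ext x
        simp only [mem_iUnion, mem_union]
        constructor
        · rintro ⟨i, hi⟩
          rcases i with _ | i
          · left; simpa using hi
          · right; exact ⟨i, by convert hi using 2; ring⟩
        · rintro (h | ⟨i, hi⟩)
          · exact ⟨0, by simpa using h⟩
          · exact ⟨i + 1, by convert hi using 2; ring⟩
      rw [ih, Finset.sum_range_succ, hU, hadd _ _ (hf k) (MeasurableSet.iUnion fun i => hf _),
        add_assoc]
      rw [disjoint_iUnion_right]
      exact fun i => hd (by lia)
  have htail : Tendsto (fun k => φ (⋃ i, f (i + k))) atTop (𝓝 0) := by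
    have hs : ∑' i, m (f i) ≠ ∞ := by
      rw [← measure_iUnion hd hf]; exact measure_ne_top _ _
    have h1 := ENNReal.tendsto_sum_nat_add (fun i => m (f i))
    refine tendsto_of_tendsto_of_tendsto_of_le_of_le tendsto_const_nhds (h1 hs)
      (fun _ => zero_le) fun k => ?_
    exact (hle _ (MeasurableSet.iUnion fun i => hf _)).trans (measure_iUnion_le _)
  have h2 : Tendsto (fun k => ∑ i ∈ Finset.range k, φ (f i) + φ (⋃ i, f (i + k))) atTop
      (𝓝 (∑' i, φ (f i) + 0)) := (ENNReal.tendsto_nat_tsum _).add htail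
  simp_rw [← hsplit, add_zero] at h2
  exact tendsto_nhds_unique tendsto_const_nhds h2

/-- If the iterated images of a finite measure `m` are uniformly dominated by `m`, then there is
an invariant probability measure dominated by a multiple of `m`. -/
theorem exists_invariant_of_map_iterate_le {X : Type*} [MeasurableSpace X] (m : Measure X)
    [IsFiniteMeasure m] (hm : m ≠ 0) {F : X → X} (hF : Measurable F) {C : ℝ≥0∞} (hC : C ≠ ∞)
    (hle : ∀ n, m.map F^[n] ≤ C • m) :
    ∃ μ : Measure X, ∃ C' : ℝ≥0∞, C' ≠ ∞ ∧ IsProbabilityMeasure μ ∧ μ ≤ C' • m ∧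
      MeasurePreserving F μ μ := by
  have hFn : ∀ n, Measurable F^[n] := fun n => hF.iterate n
  let κ : ℕ → Set X → ℝ≥0∞ := fun n A =>
    (n + 1 : ℝ≥0∞)⁻¹ * ∑ j ∈ Finset.range (n + 1), m (F^[j] ⁻¹' A)
  -- Compactness of `[0, ∞]` gives the averages a limit along an ultrafilter on every set at once,
  -- and the limit is finitely additive.
  let U : Ultrafilter ℕ := Filter.hyperfilter ℕ
  let φ : Set X → ℝ≥0∞ := fun A => (U.map fun n => κ n A).lim
  have hφ : ∀ A, Tendsto (fun n => κ n A) U (𝓝 (φ A)) := fun A =>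
    Ultrafilter.le_nhds_lim (U.map fun n => κ n A)
  have hCm : IsFiniteMeasure (C • m) := ⟨by
    simpa using ENNReal.mul_lt_top hC.lt_top (measure_lt_top m univ)⟩
  have hpos : ∀ n : ℕ, (n + 1 : ℝ≥0∞) ≠ 0 := fun n => by simp
  have htop : ∀ n : ℕ, (n + 1 : ℝ≥0∞) ≠ ∞ := fun n => by simp
  have hU : (U : Filter ℕ) ≤ atTop := Nat.hyperfilter_le_atTop
  have hterm : ∀ A, MeasurableSet A → ∀ n, m (F^[n] ⁻¹' A) ≤ (C • m) A := fun A hA n => by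
    rw [← Measure.map_apply (hFn n) hA]; exact hle n A
  have hφle : ∀ A, MeasurableSet A → φ A ≤ (C • m) A := fun A hA => by
    refine le_of_tendsto (hφ A) (Eventually.of_forall fun n => ?_)
    calc κ n A ≤ (n + 1 : ℝ≥0∞)⁻¹ * ∑ j ∈ Finset.range (n + 1), (C • m) A := by
          exact mul_le_mul' le_rfl (Finset.sum_le_sum fun j _ => hterm A hA j)
      _ = (C • m) A := by
          rw [Finset.sum_const, Finset.card_range, nsmul_eq_mul, ← mul_assoc]
          push_cast
          rw [ENNReal.inv_mul_cancel (hpos n) (htop n), one_mul]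
  obtain ⟨μ, hμ⟩ := exists_measure_of_additive_le (C • m) φ
    (by
      intro A B hA hB hd
      refine tendsto_nhds_unique (hφ (A ∪ B)) (((hφ A).add (hφ B)).congr fun n => ?_)
      simp only [κ, ← mul_add, ← Finset.sum_add_distrib, preimage_union]
      congr 1
      exact Finset.sum_congr rfl fun j _ =>
        (measure_union (hd.preimage _) (hFn j hB)).symm)
    hφle
  have hμle : μ ≤ C • m := Measure.le_iff.2 fun A hA => by
    rw [hμ A hA]
    exact hφle A hA
  have hμuniv : μ univ = m univ := by
    rw [hμ _ MeasurableSet.univ]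
    refine tendsto_nhds_unique (hφ univ) (tendsto_const_nhds.congr fun n => ?_)
    simp only [κ, preimage_univ, Finset.sum_const, Finset.card_range, nsmul_eq_mul]
    rw [← mul_assoc]
    push_cast
    rw [ENNReal.inv_mul_cancel (hpos n) (htop n), one_mul]
  have hfin : IsFiniteMeasure μ := ⟨by rw [hμuniv]; exact measure_lt_top _ _⟩
  have hmapfin : IsFiniteMeasure (μ.map F) := inferInstance
  -- One inequality suffices, since both measures have the same total mass. The average at `F ⁻¹' A`
  -- exceeds the one at `A` by at most the last term, which the factor `1 / (n + 1)` kills.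
  have hmap : μ.map F ≤ μ := Measure.le_iff.2 fun A hA => by
    rw [Measure.map_apply hF hA, hμ A hA, hμ _ (hF hA)]
    have hz : Tendsto (fun n : ℕ => (n + 1 : ℝ≥0∞)⁻¹ * (C • m) univ) U (𝓝 0) := by
      have h1 : Tendsto (fun n : ℕ => (n + 1 : ℝ≥0∞)⁻¹) atTop (𝓝 0) := by
        have := (tendsto_add_atTop_iff_nat 1).2 ENNReal.tendsto_inv_nat_nhds_zero
        simpa using this
      have h2 := ENNReal.Tendsto.mul_const (b := (C • m) univ) h1
        (Or.inr (measure_ne_top _ _))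
      rw [zero_mul] at h2
      exact h2.mono_left hU
    have hsum := (hφ A).add hz
    rw [add_zero] at hsum
    refine le_of_tendsto_of_tendsto (hφ (F ⁻¹' A)) hsum (Eventually.of_forall fun n => ?_)
    simp only [κ, ← mul_add]
    gcongr
    have e : ∀ j, m (F^[j] ⁻¹' (F ⁻¹' A)) = m (F^[j + 1] ⁻¹' A) := fun j => by
      rw [← preimage_comp, ← Function.iterate_succ']
    simp_rw [e]
    rw [Finset.sum_range_succ]
    refine add_le_add ?_ ((hterm A hA _).trans (measure_mono (subset_univ _)))
    rw [Finset.sum_range_succ' (fun j => m (F^[j] ⁻¹' A))]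
    exact le_self_add
  have hinv : μ.map F = μ := Measure.eq_of_le_of_measure_univ_eq hmap (by
    rw [Measure.map_apply hF MeasurableSet.univ, preimage_univ])
  have hm0 : m univ ≠ 0 := by simpa using hm
  refine ⟨(m univ)⁻¹ • μ, (m univ)⁻¹ * C, ENNReal.mul_ne_top (by simpa using hm0) hC, ⟨?_⟩, ?_, hF,
    ?_⟩
  · rw [Measure.smul_apply, hμuniv, smul_eq_mul,
      ENNReal.inv_mul_cancel hm0 (measure_ne_top _ _)]
  · rw [mul_smul]
    gcongr
  · rw [Measure.map_smul, hinv]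

end InvariantMeasure

/-! ### From trivial tail to mixing, via projections in `L²`. -/

section TailMixing

open scoped ENNReal

/-- Being orthogonal to `⋂ K n`, the vector `b` lies in the closure of the increasing union of the
`(K n)ᗮ`. The projections onto these therefore converge to `b`, and the complementary ones to `0`.
-/
theorem tendsto_starProjection_zero_of_antitone {E : Type*} [NormedAddCommGroup E]
    [InnerProductSpace ℝ E] [CompleteSpace E] (K : ℕ → Submodule ℝ E)
    [∀ n, (K n).HasOrthogonalProjection] (hK : Antitone K) {b : E}
    (hb : ∀ w, (∀ n, w ∈ K n) → inner ℝ w b = 0) :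
    Tendsto (fun n => (K n).starProjection b) atTop (𝓝 0) := by
  have hmono : Monotone fun n => (K n)ᗮ := fun i j h => Submodule.orthogonal_le (hK h)
  have h1 := Submodule.starProjection_tendsto_closure_iSup (fun n => (K n)ᗮ) hmono b
  have hmem : b ∈ (⨆ n, (K n)ᗮ).topologicalClosure := by
    rw [← Submodule.orthogonal_orthogonal_eq_closure, ← Submodule.iInf_orthogonal,
      Submodule.mem_orthogonal]
    intro w hw
    refine hb w fun n => ?_
    have := (Submodule.mem_iInf _).1 hw n
    rwa [Submodule.orthogonal_orthogonal] at this
  rw [Submodule.starProjection_eq_self_iff.2 hmem] at h1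
  have h2 : ∀ n, (K n).starProjection b = b - (K n)ᗮ.starProjection b := fun n => by
    have := Submodule.starProjection_add_starProjection_orthogonal (K := K n) b
    rw [← this]; simp
  simp_rw [h2]
  simpa using h1.const_sub b

/-- A measure preserving map whose tail sets (modulo null sets) are trivial is mixing. -/
theorem isMixing_of_tail_trivial {X : Type*} [MeasurableSpace X] {μ : Measure X}
    [IsProbabilityMeasure μ] {F : X → X} (hF : MeasurePreserving F μ μ)
    (htail : ∀ A : Set X, MeasurableSet A →
      (∀ n : ℕ, ∃ B, MeasurableSet B ∧ A =ᵐ[μ] F^[n] ⁻¹' B) → μ A = 0 ∨ μ Aᶜ = 0) :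
    IsMixing F μ := by
  refine ⟨hF, fun A B hA hB => ?_⟩
  let V : ∀ n, Lp ℝ 2 μ →ₗᵢ[ℝ] Lp ℝ 2 μ := fun n =>
    Lp.compMeasurePreservingₗᵢ ℝ F^[n] (hF.iterate n)
  -- The ranges of the powers of the Koopman operator decrease. A vector of their intersection has
  -- level sets that are tail sets modulo null sets, so it is constant and hence orthogonal to the
  -- centred indicator `b`.
  let K : ℕ → Submodule ℝ (Lp ℝ 2 μ) := fun n => LinearMap.range (V n).toLinearMap
  have hcomplete : ∀ n, (K n).HasOrthogonalProjection := fun n => by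
    have : CompleteSpace (K n) := IsComplete.completeSpace_coe (s := (K n : Set (Lp ℝ 2 μ))) (by
      have := (V n).isometry.isUniformInducing.isComplete_range
      exact this)
    infer_instance
  have hVae : ∀ n g, (V n g : X → ℝ) =ᵐ[μ] g ∘ F^[n] := fun n g =>
    Lp.coeFn_compMeasurePreserving g (hF.iterate n)
  have hKanti : Antitone K := by
    refine antitone_nat_of_succ_le fun n => ?_
    rintro _ ⟨g, rfl⟩
    refine ⟨Lp.compMeasurePreserving F hF g, ?_⟩
    apply Lp.ext
    have h1 := hVae n (Lp.compMeasurePreserving F hF g)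
    have h2 := hVae (n + 1) g
    have h3 := (hF.iterate n).quasiMeasurePreserving.ae_eq_comp
      (Lp.coeFn_compMeasurePreserving g hF)
    refine h1.trans (h3.trans (EventuallyEq.trans ?_ h2.symm))
    rw [Function.iterate_succ']
    rfl
  let ind : ∀ S : Set X, MeasurableSet S → Lp ℝ 2 μ := fun S hS =>
    indicatorConstLp 2 hS (measure_ne_top μ S) (1 : ℝ)
  have hind : ∀ S T (hS : MeasurableSet S) (hT : MeasurableSet T),
      inner ℝ (ind S hS) (ind T hT) = μ.real (S ∩ T) := fun S T hS hT =>
    L2.real_inner_indicatorConstLp_one_indicatorConstLp_one hS hT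
  have hVind : ∀ n, V n (ind A hA) = ind (F^[n] ⁻¹' A) ((hF.iterate n).measurable hA) := fun n =>
    Lp.indicatorConstLp_compMeasurePreserving hA (measure_ne_top μ A) 1 (hF.iterate n)
  let b : Lp ℝ 2 μ := ind B hB - μ.real B • ind univ MeasurableSet.univ
  have hproj := tendsto_starProjection_zero_of_antitone K hKanti (b := b) (by
    intro w hw
    obtain ⟨c, hc⟩ : ∃ c, (w : X → ℝ) =ᵐ[μ] Function.const X c := by
      refine exists_eventuallyEq_const_of_forall_separating MeasurableSet fun U hU => ?_
      have hwm := (Lp.stronglyMeasurable w).measurable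
      rcases htail (w ⁻¹' U) (hwm hU) (fun n => by
        obtain ⟨g, hg⟩ := hw n
        refine ⟨g ⁻¹' U, (Lp.stronglyMeasurable g).measurable hU, ?_⟩
        have h1 := hVae n g
        have h2 : V n g = w := hg
        rw [h2] at h1
        filter_upwards [h1] with x hx
        change (w x ∈ U) = (g (F^[n] x) ∈ U)
        rw [hx]; rfl) with h | h
      · right; exact measure_eq_zero_iff_ae_notMem.1 h
      · left; simpa using measure_eq_zero_iff_ae_notMem.1 h
    have hw1 : w = c • ind univ MeasurableSet.univ := by
      apply Lp.ext
      have h1 := Lp.coeFn_smul c (ind univ MeasurableSet.univ)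
      have h2 : (ind univ MeasurableSet.univ : X → ℝ) =ᵐ[μ] _ :=
        indicatorConstLp_coeFn (p := 2) (hs := MeasurableSet.univ) (hμs := measure_ne_top μ univ)
          (c := (1 : ℝ))
      filter_upwards [hc, h1, h2] with x h3 h4 h5
      rw [h3, h4, Pi.smul_apply, h5]
      simp
    rw [hw1, inner_smul_left, inner_sub_right, inner_smul_right, hind, hind]
    simp)
  have hreal : Tendsto (fun n => μ.real (F^[n] ⁻¹' A ∩ B)) atTop (𝓝 (μ.real A * μ.real B)) := by
    -- The correlation is the inner product of `V n 1_A` with `b`; since `V n 1_A` lies in `K n`,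
    -- only the projection of `b` to `K n` matters.
    have hinner : ∀ n, μ.real (F^[n] ⁻¹' A ∩ B) - μ.real A * μ.real B =
        inner ℝ (V n (ind A hA)) ((K n).starProjection b) := fun n => by
      have hm : V n (ind A hA) ∈ K n := ⟨ind A hA, rfl⟩
      rw [← Submodule.inner_starProjection_left_eq_right,
        Submodule.starProjection_eq_self_iff.2 hm, hVind]
      simp only [b]
      rw [inner_sub_right, inner_smul_right, hind, hind, inter_univ,
        (hF.iterate n).measureReal_preimage hA.nullMeasurableSet, mul_comm]
    have h0 : Tendsto (fun n => inner ℝ (V n (ind A hA)) ((K n).starProjection b)) atTop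
        (𝓝 (0 : ℝ)) := by
      have h1 := hproj.norm.const_mul ‖ind A hA‖
      rw [norm_zero, mul_zero] at h1
      refine squeeze_zero_norm (fun n => ?_) h1
      calc ‖inner ℝ (V n (ind A hA)) ((K n).starProjection b)‖
          ≤ ‖V n (ind A hA)‖ * ‖(K n).starProjection b‖ := norm_inner_le_norm _ _
        _ = _ := by rw [(V n).norm_map]
    simp_rw [← hinner] at h0
    simpa using h0.add_const (μ.real A * μ.real B)
  have h1 := (ENNReal.continuous_ofReal.tendsto _).comp hreal
  rw [ENNReal.ofReal_mul measureReal_nonneg] at h1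
  simpa [Function.comp_def, ofReal_measureReal] using h1

end TailMixing

/-! ### Exact components, their parity, and uniqueness of acips. -/

section MixingComponents

open scoped ENNReal

/-- `HasMixingComponents` asks for sets that are literally disjoint with union exactly the support,
whereas atoms of the tail are only known up to null sets. The uncovered null part is added to every
set, and each point is then kept in the first set that contains it. -/
theorem exists_disjoint_ae_refinement {X : Type*} [MeasurableSpace X] {μ : Measure X} {k : ℕ}
    (E : Fin k → Set X) (hE : ∀ j, MeasurableSet (E j))
    (hd : Pairwise fun i j => μ (E i ∩ E j) = 0) (hU : μ (⋃ j, E j)ᶜ = 0) (hk : 0 < k)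
    {Z : Set X} (hZ : MeasurableSet Z) (hZ0 : μ Zᶜ = 0) :
    ∃ S : Fin k → Set X, (∀ j, MeasurableSet (S j)) ∧ (∀ i j, i ≠ j → Disjoint (S i) (S j)) ∧
      (⋃ j, S j) = Z ∧ ∀ j, S j =ᵐ[μ] E j := by
  let T : Fin k → Set X := fun j => E j ∪ (⋃ i, E i)ᶜ
  have hT : ∀ j, MeasurableSet (T j) := fun j => (hE j).union (MeasurableSet.iUnion hE).compl
  have hTE : ∀ j, T j =ᵐ[μ] E j := fun j => by
    have := (EventuallyEq.refl (ae μ) (E j)).union (ae_eq_empty.2 hU)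
    simpa [T] using this
  let R : Fin k → Set X := fun j => T j \ ⋃ i, ⋃ (_ : i < j), T i
  have hR : ∀ j, MeasurableSet (R j) := fun j =>
    (hT j).diff (MeasurableSet.iUnion fun i => MeasurableSet.iUnion fun _ => hT i)
  have hRT : ∀ j, R j =ᵐ[μ] T j := fun j => by
    refine sdiff_ae_eq_self.2 ?_
    rw [inter_iUnion₂, measure_iUnion_null_iff]
    intro i
    rw [measure_iUnion_null_iff]
    intro hij
    rw [measure_congr ((hTE j).inter (hTE i))]
    exact hd hij.ne'
  refine ⟨fun j => Z ∩ R j, fun j => hZ.inter (hR j), ?_, ?_, ?_⟩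
  · have key : ∀ i j, i < j → Disjoint (Z ∩ R i) (Z ∩ R j) := fun i j hij => by
      rw [Set.disjoint_left]
      rintro x ⟨_, hx⟩ ⟨_, hx'⟩
      exact hx'.2 (mem_iUnion₂.2 ⟨i, hij, hx.1⟩)
    intro i j hij
    rcases lt_or_gt_of_ne hij with h | h
    · exact key i j h
    · exact (key j i h).symm
  · rw [← inter_iUnion, inter_eq_left]
    intro x _
    have hex : ∃ j, x ∈ T j := by
      by_cases h : x ∈ ⋃ i, E i
      · obtain ⟨i, hi⟩ := mem_iUnion.1 h
        exact ⟨i, Or.inl hi⟩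
      · exact ⟨⟨0, hk⟩, Or.inr h⟩
    obtain ⟨j, hj, hmin⟩ := WellFounded.has_min (wellFounded_lt (α := Fin k)) {j | x ∈ T j} hex
    refine mem_iUnion.2 ⟨j, hj, fun h => ?_⟩
    obtain ⟨i, hij, hi⟩ := mem_iUnion₂.1 h
    exact hmin i hi hij
  · intro j
    have h1 : Z =ᵐ[μ] univ := eventuallyEq_univ.2 (by rwa [mem_ae_iff])
    have := h1.inter (hRT j)
    rw [univ_inter] at this
    exact this.trans (hTE j)

/-- An ergodic map whose tail sets of positive measure have measure bounded below has finitely many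
exact components, which it permutes cyclically. -/
theorem exists_hasMixingComponents {X : Type*} [TopologicalSpace X] [SecondCountableTopology X]
    [MeasurableSpace X] [OpensMeasurableSpace X] {μ : Measure X} [IsProbabilityMeasure μ]
    {F : X → X} (hF : Ergodic F μ) {δ : ℝ≥0∞} (hδ : δ ≠ 0)
    (htail : ∀ A : Set X, (∀ n : ℕ, ∃ B, MeasurableSet B ∧ F^[n] ⁻¹' B = A) → μ A ≠ 0 → δ ≤ μ A) :
    ∃ k, HasMixingComponents F μ k := by
  have hFm : Measurable F := hF.measurable
  let Tail : Set X → Prop := fun A => ∀ n : ℕ, ∃ B, MeasurableSet B ∧ F^[n] ⁻¹' B = A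
  have tail_meas : ∀ {A}, Tail A → MeasurableSet A := fun hA => by
    obtain ⟨B, hB, rfl⟩ := hA 0; simpa using hB
  have tail_inter : ∀ {A B}, Tail A → Tail B → Tail (A ∩ B) := fun hA hB n => by
    obtain ⟨A', hA', rfl⟩ := hA n
    obtain ⟨B', hB', rfl⟩ := hB n
    exact ⟨A' ∩ B', hA'.inter hB', preimage_inter⟩
  have tail_diff : ∀ {A B}, Tail A → Tail B → Tail (A \ B) := fun hA hB n => by
    obtain ⟨A', hA', rfl⟩ := hA n
    obtain ⟨B', hB', rfl⟩ := hB n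
    exact ⟨A' \ B', hA'.diff hB', preimage_sdiff _ _ _⟩
  have tail_pre : ∀ {A}, Tail A → ∀ j, Tail (F^[j] ⁻¹' A) := fun hA j n => by
    obtain ⟨A', hA', rfl⟩ := hA n
    refine ⟨F^[j] ⁻¹' A', hFm.iterate j hA', ?_⟩
    rw [← preimage_comp, ← preimage_comp, ← Function.iterate_add, ← Function.iterate_add, add_comm]
  -- This infimum is positive by the hypothesis on `δ`, so a tail set of measure less than `I + I`
  -- cannot split into two nonnull tail sets: it is an atom.
  let I : ℝ≥0∞ := sInf {r | ∃ A, Tail A ∧ μ A ≠ 0 ∧ r = μ A}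
  have hI : δ ≤ I := le_sInf (by rintro _ ⟨A, hA, h0, rfl⟩; exact htail A hA h0)
  have hIle : ∀ {A}, Tail A → μ A ≠ 0 → I ≤ μ A := fun hA h0 => sInf_le ⟨_, hA, h0, rfl⟩
  have huniv : Tail univ := fun n => ⟨univ, MeasurableSet.univ, preimage_univ⟩
  have hI1 : I ≤ 1 := (hIle huniv (by simp)).trans_eq measure_univ
  have hI0 : I ≠ 0 := fun h => hδ (le_antisymm (h ▸ hI) zero_le)
  have hItop : I ≠ ∞ := ne_top_of_le_ne_top ENNReal.one_ne_top hI1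
  obtain ⟨_, ⟨A, hA, hA0, rfl⟩, hA2⟩ := sInf_lt_iff.1
    (show I < I + I from ENNReal.lt_add_right hItop hI0)
  have atom : ∀ {E B}, Tail E → μ E < I + I → Tail B → μ (E ∩ B) = 0 ∨ μ (E \ B) = 0 := by
    intro E B hE hE2 hB
    by_contra! h
    refine absurd hE2 (not_lt.2 ?_)
    rw [← measure_inter_add_sdiff E (tail_meas hB)]
    exact add_le_add (hIle (tail_inter hE hB) h.1) (hIle (tail_diff hE hB) h.2)
  let E : ℕ → Set X := fun j => F^[j] ⁻¹' A
  have hEt : ∀ j, Tail (E j) := tail_pre hA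
  have hEm : ∀ j, MeasurableSet (E j) := fun j => tail_meas (hEt j)
  have hEμ : ∀ j, μ (E j) = μ A := fun j =>
    (hF.toMeasurePreserving.iterate j).measure_preimage (tail_meas hA).nullMeasurableSet
  have hEadd : ∀ i j, F^[i] ⁻¹' (E j) = E (i + j) := fun i j => by
    simp only [E]
    rw [← preimage_comp, ← Function.iterate_add, add_comm]
  have hE2 : ∀ j, μ (E j) < I + I := fun j => by rw [hEμ]; exact hA2
  -- Poincaré recurrence. The least such `k` is the number of components: for atoms of equal
  -- measure, meeting in positive measure means being equal almost everywhere.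
  have hex : ∃ k, 0 < k ∧ μ (A ∩ E k) ≠ 0 := by
    have h := (hF.toMeasurePreserving.conservative).frequently_measure_inter_ne_zero
      (tail_meas hA).nullMeasurableSet hA0
    obtain ⟨k, hk, hk'⟩ := (frequently_atTop.1 h) 1
    exact ⟨k, hk, hk'⟩
  classical
  set k := Nat.find hex with hkdef
  obtain ⟨hk0, hkne⟩ := Nat.find_spec hex
  have hkmin : ∀ j, 0 < j → j < k → μ (A ∩ E j) = 0 := fun j hj hjk => by
    by_contra h
    exact Nat.find_min hex hjk ⟨hj, h⟩
  have hAE : A =ᵐ[μ] E k := by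
    have h1 : μ (A \ E k) = 0 := (atom hA hA2 (hEt k)).resolve_left hkne
    refine ae_eq_of_ae_subset_of_measure_ge (ae_le_set.2 h1) (hEμ k).le
      (tail_meas hA).nullMeasurableSet (measure_ne_top _ _)
  have hdis : ∀ i j, i < j → j < k → μ (E i ∩ E j) = 0 := fun i j hij hjk => by
    have : E i ∩ E j = F^[i] ⁻¹' (A ∩ E (j - i)) := by
      rw [preimage_inter, hEadd, Nat.add_sub_cancel' hij.le]
    rw [this, (hF.toMeasurePreserving.iterate i).measure_preimage
      ((tail_meas hA).inter (hEm _)).nullMeasurableSet]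
    exact hkmin _ (by lia) (by lia)
  have hFE : ∀ j, F ⁻¹' E j = E (j + 1) := fun j => by
    have := hEadd 1 j
    rwa [Function.iterate_one, add_comm] at this
  -- The order is reversed because preimages raise the index of `E`, while the components must
  -- satisfy that the preimage of the next one is the present one.
  let S₀ : Fin k → Set X := fun j => E (k - 1 - j)
  have hrot : ∀ j, F ⁻¹' S₀ (finRotate k j) =ᵐ[μ] S₀ j := fun j => by
    have hfr : ((finRotate k j : Fin k) : ℕ) = (j + 1) % k := by
      have : NeZero k := ⟨hk0.ne'⟩
      rw [finRotate_apply, Fin.val_add, Fin.val_one', Nat.add_mod_mod]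
    simp only [S₀]
    rw [hfr, hFE]
    rcases Nat.lt_or_ge (j + 1) k with h | h
    · rw [Nat.mod_eq_of_lt h]
      have : k - 1 - (j + 1) + 1 = k - 1 - (j : ℕ) := by lia
      rw [this]
      exact EventuallyEq.rfl
    · have h2 : (j : ℕ) + 1 = k := le_antisymm j.2 h
      rw [h2, Nat.mod_self]
      have h3 : k - 1 - 0 + 1 = k := by lia
      have h4 : k - 1 - (j : ℕ) = 0 := by lia
      rw [h3, h4]
      exact hAE.symm
  have hunion : μ (⋃ j, S₀ j)ᶜ = 0 := by
    have hinv : F ⁻¹' (⋃ j, S₀ j) =ᵐ[μ] ⋃ j, S₀ j := by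
      have h1 : (⋃ j, S₀ j) = ⋃ j, S₀ (finRotate k j) :=
        ((finRotate k).surjective.iUnion_comp S₀).symm
      rw [h1, preimage_iUnion, ← h1]
      exact Filter.EventuallyEq.countable_iUnion hrot
    rcases hF.quasiErgodic.ae_empty_or_univ₀
      (MeasurableSet.iUnion fun j => hEm _).nullMeasurableSet hinv with h | h
    · exfalso
      have h1 := measure_mono_null (subset_iUnion S₀ ⟨0, hk0⟩) (ae_eq_empty.1 h)
      rw [hEμ] at h1
      exact hA0 h1
    · rw [eventuallyEq_univ] at h
      exact h
  obtain ⟨S, hS, hSd, hSU, hSE⟩ := exists_disjoint_ae_refinement (μ := μ) S₀ (fun j => hEm _) (by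
      intro i j hij
      have h1 : k - 1 - (i : ℕ) ≠ k - 1 - (j : ℕ) := by
        intro h; apply hij; ext; have := i.2; have := j.2; lia
      rcases lt_or_gt_of_ne h1 with h | h
      · exact hdis _ _ h (by lia)
      · simp only [S₀]
        rw [inter_comm]; exact hdis _ _ h (by lia)) hunion hk0
    (Measure.isClosed_support (μ := μ)).measurableSet Measure.measure_compl_support
  have hSμ : ∀ j, μ (S j) ≠ 0 := fun j => by
    rw [measure_congr (hSE j), hEμ]; exact hA0
  have hkS : ∀ j, F^[k] ⁻¹' S j =ᵐ[μ] S j := fun j => by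
    have h1 := (hF.toMeasurePreserving.iterate k).quasiMeasurePreserving.preimage_ae_eq (hSE j)
    refine h1.trans (EventuallyEq.trans ?_ (hSE j).symm)
    simp only [S₀]
    rw [hEadd, add_comm, ← hEadd]
    exact (hF.toMeasurePreserving.iterate _).quasiMeasurePreserving.preimage_ae_eq hAE.symm
  refine ⟨k, S, hS, hSμ, hSd, hSU, fun j => ?_, fun j => ⟨?_, fun B hB => ?_⟩⟩
  · exact (hF.toMeasurePreserving.quasiMeasurePreserving.preimage_ae_eq (hSE _)).trans
      ((hrot j).trans (hSE j).symm)
  · have h1 := (hF.toMeasurePreserving.iterate k).restrict_preimage (hS j)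
    rw [Measure.restrict_congr_set (hkS j)] at h1
    exact h1.smul_measure _
  -- A tail set of `F^[k]` is a tail set of `F`, since `n ≤ k * n`; the atom property then gives
  -- exactness.
  · have hBt : Tail B := fun n => by
      obtain ⟨C, hC, hCB⟩ := hB n
      rw [← Function.iterate_mul] at hCB
      have hle : n ≤ k * n := Nat.le_mul_of_pos_left n hk0
      refine ⟨F^[k * n - n] ⁻¹' C, hFm.iterate _ hC, ?_⟩
      rw [← preimage_comp, ← Function.iterate_add, Nat.sub_add_cancel hle, hCB]
    rcases atom (hEt (k - 1 - j)) (hE2 _) hBt with h | h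
    · left
      rw [ProbabilityTheory.cond_apply (hS j), measure_congr ((hSE j).inter (EventuallyEq.refl _ B))]
      simp only [S₀]
      rw [h, mul_zero]
    · right
      rw [ProbabilityTheory.cond_apply (hS j),
        measure_congr (show (S j ∩ Bᶜ : Set X) =ᵐ[μ] (S₀ j ∩ Bᶜ : Set X) from
          (hSE j).inter EventuallyEq.rfl)]
      simp only [S₀]
      rw [← sdiff_eq, h, mul_zero]

/-- If a map exchanges, up to null sets, a set and its complement, then the number of its mixing
components is even. -/
theorem HasMixingComponents.even_of_preimage_ae_eq_compl {X : Type*} [TopologicalSpace X]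
    [MeasurableSpace X] {μ : Measure X} [IsProbabilityMeasure μ] {F : X → X}
    (hF : MeasurePreserving F μ μ) {U : Set X} (hU : MeasurableSet U) (hFU : F ⁻¹' U =ᵐ[μ] Uᶜ)
    {k : ℕ} (h : HasMixingComponents F μ k) : Even k := by
  by_contra hodd
  rw [Nat.not_even_iff_odd] at hodd
  obtain ⟨S, hS, hS0, -, -, -, hex⟩ := h
  have hk0 : 0 < k := hodd.pos
  obtain ⟨hmp, htriv⟩ := hex ⟨0, hk0⟩
  set ν := ProbabilityTheory.cond μ (S ⟨0, hk0⟩) with hν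
  have hprob : IsProbabilityMeasure ν := ProbabilityTheory.cond_isProbabilityMeasure (hS0 _)
  have hac : ν ≪ μ := ProbabilityTheory.cond_absolutelyContinuous
  have hq : ∀ n, Measure.QuasiMeasurePreserving F^[n] μ μ := fun n =>
    (hF.iterate n).quasiMeasurePreserving
  have hpar : ∀ n, F^[2 * n] ⁻¹' U =ᵐ[μ] U ∧ F^[2 * n + 1] ⁻¹' U =ᵐ[μ] Uᶜ := by
    intro n
    induction n with
    | zero => exact ⟨EventuallyEq.rfl, by simpa using hFU⟩
    | succ n ih =>
      have h1 : F^[2 * (n + 1)] ⁻¹' U =ᵐ[μ] U := by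
        have := (hq 1).preimage_ae_eq ih.2
        rw [← preimage_comp, ← Function.iterate_add] at this
        refine this.trans ?_
        have h2 : (F ⁻¹' U)ᶜ =ᵐ[μ] (Uᶜᶜ : Set X) := hFU.compl
        rw [compl_compl] at h2
        exact h2
      refine ⟨h1, ?_⟩
      have := (hq 1).preimage_ae_eq h1
      rw [← preimage_comp, ← Function.iterate_add] at this
      exact this.trans (by simpa using hFU)
  -- `U` is only almost invariant under `F^[2]`, but exactness speaks of genuine preimages. `A` is a
  -- version of `U` that is strictly invariant under `F^[2]`, hence a tail set of every `F^[k]`.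
  let A : Set X := {x | ∃ᶠ n in atTop, F^[2 * n] x ∈ U}
  have hA : MeasurableSet A := by
    have : A = limsup (fun n => F^[2 * n] ⁻¹' U) atTop := by
      rw [limsup_eq_iInf_iSup_of_nat]
      ext x
      simp [A, frequently_atTop]
    rw [this]
    exact MeasurableSet.measurableSet_limsup fun n => hF.measurable.iterate _ hU
  have hAinv : ∀ m, F^[2 * m] ⁻¹' A = A := fun m => by
    ext x
    simp only [A, mem_preimage, mem_ofPred_eq, ← Function.iterate_add_apply, ← mul_add]
    constructor
    · intro h
      exact (tendsto_add_atTop_nat m).frequently h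
    · intro h
      rw [frequently_atTop] at h ⊢
      intro a
      obtain ⟨b, hb, hb'⟩ := h (a + m)
      exact ⟨b - m, by lia, by rwa [Nat.sub_add_cancel (by lia)]⟩
  have hAU : A =ᵐ[μ] U := by
    have : ∀ᵐ x ∂μ, ∀ n, (F^[2 * n] x ∈ U ↔ x ∈ U) := ae_all_iff.2 fun n => by
      filter_upwards [(hpar n).1] with x hx
      exact iff_of_eq hx
    filter_upwards [this] with x hx
    refine propext ?_
    change (∃ᶠ n in atTop, F^[2 * n] x ∈ U) ↔ x ∈ U
    simp_rw [hx]
    simp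
  -- For odd `k` the map `F^[k]` exchanges `U` and `Uᶜ` while preserving `ν`. Both then have measure
  -- one half, against the triviality of the tail.
  have hhalf : ν U = ν Uᶜ := by
    obtain ⟨l, hl⟩ := hodd
    have h1 : F^[k] ⁻¹' U =ᵐ[μ] Uᶜ := by
      have := (hpar l).2
      rwa [← hl] at this
    rw [← hmp.measure_preimage hU.nullMeasurableSet]
    exact measure_congr (hac.ae_le h1)
  have hsum : ν U + ν Uᶜ = 1 := prob_add_prob_compl hU
  have hAν : A =ᵐ[ν] U := hac.ae_le hAU
  rcases htriv A (fun n => ⟨F^[k * n] ⁻¹' A, hF.measurable.iterate _ hA, by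
      rw [← Function.iterate_mul, ← preimage_comp, ← Function.iterate_add, ← two_mul, hAinv]⟩)
    with h | h
  · rw [measure_congr hAν] at h
    rw [← hhalf, h] at hsum
    simp at hsum
  · rw [measure_congr hAν.compl] at h
    rw [hhalf, h] at hsum
    simp at hsum

/-- If every strictly invariant set is null or conull for the reference measure, then every
absolutely continuous invariant measure is ergodic. -/
theorem IsAcip.ergodic {X : Type*} [MeasurableSpace X] {m μ : Measure X} {F : X → X}
    (h : IsAcip m F μ)
    (hm : ∀ A, MeasurableSet A → F ⁻¹' A = A → m A = 0 ∨ m Aᶜ = 0) : Ergodic F μ := by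
  refine ⟨h.measurePreserving, ⟨fun A hA hFA => ?_⟩⟩
  rw [eventuallyConst_set']
  rcases hm A hA hFA with h0 | h0
  · left; exact ae_eq_empty.2 (h.absolutelyContinuous h0)
  · right
    rw [eventuallyEq_univ, mem_ae_iff]
    exact h.absolutelyContinuous h0

/-- The midpoint of two acips is again an acip, hence ergodic, and each of the two is absolutely
continuous with respect to it; an ergodic measure equals any such invariant probability measure. -/
theorem IsAcip.eq {X : Type*} [MeasurableSpace X] {m μ ν : Measure X} {F : X → X}
    (hμ : IsAcip m F μ) (hν : IsAcip m F ν)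
    (hm : ∀ A, MeasurableSet A → F ⁻¹' A = A → m A = 0 ∨ m Aᶜ = 0) : ν = μ := by
  have := hμ.isProbabilityMeasure
  have := hν.isProbabilityMeasure
  let π : Measure X := (2 : ℝ≥0∞)⁻¹ • (μ + ν)
  have hπ : IsAcip m F π := by
    refine ⟨⟨?_⟩, ?_, hμ.measurePreserving.measurable, ?_⟩
    · simp only [π, Measure.smul_apply, Measure.add_apply, measure_univ, smul_eq_mul]
      rw [one_add_one_eq_two]
      exact ENNReal.inv_mul_cancel (by simp) (by simp)
    · exact Measure.AbsolutelyContinuous.smul_left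
        (Measure.AbsolutelyContinuous.add_left_iff.2
          ⟨hμ.absolutelyContinuous, hν.absolutelyContinuous⟩) _
    · rw [Measure.map_smul, Measure.map_add _ _ hμ.measurePreserving.measurable,
        hμ.measurePreserving.map_eq, hν.measurePreserving.map_eq]
  have hπp := hπ.isProbabilityMeasure
  have hπe := hπ.ergodic hm
  have h2 : (2 : ℝ≥0∞)⁻¹ ≠ 0 := by simp
  have hac : μ + ν ≪ π := Measure.absolutelyContinuous_smul h2
  rw [hπe.eq_of_absolutelyContinuous hμ.measurePreserving
      (Measure.AbsolutelyContinuous.trans (Measure.AbsolutelyContinuous.add_right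
        Measure.AbsolutelyContinuous.rfl ν) hac),
    hπe.eq_of_absolutelyContinuous hν.measurePreserving
      (Measure.AbsolutelyContinuous.trans (add_comm μ ν ▸ Measure.AbsolutelyContinuous.add_right
        Measure.AbsolutelyContinuous.rfl μ) hac)]

end MixingComponents

/-! ### Lebesgue measure on `[0, L]` and measures with step densities. -/

section StepMeasures

open scoped ENNReal

/-- Lebesgue measure on `[0, L]`. -/
noncomputable abbrev lebIcc (L : ℝ) : Measure (Icc (0 : ℝ) L) :=
  (volume : Measure ℝ).comap Subtype.val

/-- The points of `[0, L]` strictly between `a` and `b`. -/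
def subIoo (L a b : ℝ) : Set (Icc (0 : ℝ) L) := Subtype.val ⁻¹' Ioo a b

theorem mem_subIoo {L a b : ℝ} {x : Icc (0 : ℝ) L} :
    x ∈ subIoo L a b ↔ a < (x : ℝ) ∧ (x : ℝ) < b := Iff.rfl

theorem measurableSet_subIoo (L a b : ℝ) : MeasurableSet (subIoo L a b) :=
  measurable_subtype_coe measurableSet_Ioo

theorem lebIcc_apply (L : ℝ) (A : Set (Icc (0 : ℝ) L)) :
    lebIcc L A = volume (Subtype.val '' A) :=
  (MeasurableEmbedding.subtype_coe measurableSet_Icc).comap_apply _ _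

theorem lebIcc_univ (L : ℝ) : lebIcc L univ = ENNReal.ofReal L := by
  rw [lebIcc_apply, image_univ, Subtype.range_coe, Real.volume_Icc, sub_zero]

instance (L : ℝ) : IsFiniteMeasure (lebIcc L) := ⟨by rw [lebIcc_univ]; exact ENNReal.ofReal_lt_top⟩

theorem image_subIoo {L a b : ℝ} (ha : 0 ≤ a) (hb : b ≤ L) :
    Subtype.val '' subIoo L a b = Ioo a b := by
  rw [subIoo, Subtype.image_preimage_coe, inter_eq_right]
  exact fun x hx => ⟨ha.trans hx.1.le, hx.2.le.trans hb⟩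

theorem lebIcc_subIoo {L a b : ℝ} (ha : 0 ≤ a) (hb : b ≤ L) :
    lebIcc L (subIoo L a b) = ENNReal.ofReal (b - a) := by
  rw [lebIcc_apply, image_subIoo ha hb, Real.volume_Ioo]

theorem lebIcc_singleton {L : ℝ} (x : Icc (0 : ℝ) L) : lebIcc L {x} = 0 := by
  rw [lebIcc_apply, image_singleton, Real.volume_singleton]

instance (L : ℝ) : NullSingletonClass (lebIcc L) := ⟨lebIcc_singleton⟩

theorem lebIcc_subIoo_inter {L a b : ℝ} {A : Set (Icc (0 : ℝ) L)} :
    lebIcc L (subIoo L a b ∩ A) = volume (Ioo a b ∩ Subtype.val '' A) := by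
  rw [lebIcc_apply, subIoo, image_preimage_inter]

/-- `F` maps the points strictly between `a` and `b` affinely, with slope `s`. -/
def AffineOnIoo {L : ℝ} (F : Icc (0 : ℝ) L → Icc (0 : ℝ) L) (a b s t : ℝ) : Prop :=
  ∀ x : Icc (0 : ℝ) L, a < (x : ℝ) → (x : ℝ) < b → (F x : ℝ) = s * x + t

variable {L : ℝ} {F : Icc (0 : ℝ) L → Icc (0 : ℝ) L}

theorem AffineOnIoo.mono {a b s t a' b' : ℝ} (h : AffineOnIoo F a b s t) (ha : a ≤ a')
    (hb : b' ≤ b) : AffineOnIoo F a' b' s t :=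
  fun x h1 h2 => h x (ha.trans_lt h1) (h2.trans_le hb)

theorem AffineOnIoo.mem_Icc {a b s t : ℝ} (h : AffineOnIoo F a b s t) (ha : 0 ≤ a) (hab : a < b)
    (hb : b ≤ L) {x : ℝ} (hx : x ∈ Icc a b) : s * x + t ∈ Icc 0 L := by
  have hmaps : MapsTo (fun x => s * x + t) (Ioo a b) (Icc 0 L) := fun y hy => by
    have := h ⟨y, ha.trans hy.1.le, hy.2.le.trans hb⟩ hy.1 hy.2
    change s * y + t ∈ _
    rw [← this]
    exact (F _).2
  have hc := hmaps.closure (by fun_prop)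
  rw [closure_Ioo hab.ne, isClosed_Icc.closure_eq] at hc
  exact hc hx

theorem mem_Ioo_min_max_iff {a b s t x : ℝ} (hab : a < b) (hs : s ≠ 0) :
    s * x + t ∈ Ioo (min (s * a + t) (s * b + t)) (max (s * a + t) (s * b + t)) ↔
      x ∈ Ioo a b := by
  rcases lt_or_gt_of_ne hs with h | h
  · have h1 : s * b + t ≤ s * a + t := by nlinarith
    rw [min_eq_right h1, max_eq_left h1, mem_Ioo, mem_Ioo, and_comm, add_lt_add_iff_right,
      add_lt_add_iff_right, mul_lt_mul_left_of_neg h, mul_lt_mul_left_of_neg h]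
  · have h1 : s * a + t ≤ s * b + t := by nlinarith
    rw [min_eq_left h1, max_eq_right h1, mem_Ioo, mem_Ioo, add_lt_add_iff_right,
      add_lt_add_iff_right, mul_lt_mul_iff_right₀ h, mul_lt_mul_iff_right₀ h]

theorem max_sub_min_affine {a b s t : ℝ} (hab : a < b) :
    max (s * a + t) (s * b + t) - min (s * a + t) (s * b + t) = |s| * (b - a) := by
  rw [max_sub_min_eq_abs, show s * b + t - (s * a + t) = s * (b - a) by ring, abs_mul,
    abs_of_pos (sub_pos.2 hab)]

theorem AffineOnIoo.map_restrict {a b s t : ℝ} (h : AffineOnIoo F a b s t) (hF : Measurable F)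
    (ha : 0 ≤ a) (hab : a < b) (hb : b ≤ L) (hs : s ≠ 0) :
    ((lebIcc L).restrict (subIoo L a b)).map F = ENNReal.ofReal |s|⁻¹ •
      (lebIcc L).restrict
        (subIoo L (min (s * a + t) (s * b + t)) (max (s * a + t) (s * b + t))) := by
  ext A hA
  rw [Measure.map_apply hF hA, Measure.restrict_apply (hF hA), inter_comm, Measure.smul_apply,
    Measure.restrict_apply hA, inter_comm A, lebIcc_subIoo_inter, lebIcc_subIoo_inter, smul_eq_mul]
  have hset : Ioo a b ∩ Subtype.val '' (F ⁻¹' A) = (fun x => s * x) ⁻¹' ((fun x => x + t) ⁻¹'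
      (Ioo (min (s * a + t) (s * b + t)) (max (s * a + t) (s * b + t)) ∩ Subtype.val '' A)) := by
    ext x
    simp only [mem_inter_iff, mem_preimage]
    rw [mem_Ioo_min_max_iff hab hs]
    refine and_congr_right fun hx => ?_
    have hxL : x ∈ Icc 0 L := ⟨ha.trans hx.1.le, hx.2.le.trans hb⟩
    have hFx := h ⟨x, hxL⟩ hx.1 hx.2
    constructor
    · rintro ⟨y, hy, rfl⟩
      exact ⟨F y, hy, hFx⟩
    · rintro ⟨y, hy, hyx⟩
      refine ⟨⟨x, hxL⟩, ?_, rfl⟩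
      have : F ⟨x, hxL⟩ = y := Subtype.ext (hFx.trans hyx.symm)
      rw [mem_preimage, this]
      exact hy
  rw [hset, Real.volume_preimage_mul_left hs, measure_preimage_add_right, abs_inv]

/-- `StepMeasure L ν V M`: the measure `ν` on `[0, L]` is a finite sum of weighted Lebesgue
measures on intervals, `V` is the sum of the weights and `M` is the total mass. -/
inductive StepMeasure (L : ℝ) : Measure (Icc (0 : ℝ) L) → ℝ → ℝ → Prop
  | zero : StepMeasure L 0 0 0
  | add {ν : Measure (Icc (0 : ℝ) L)} {V M w a b : ℝ} (hν : StepMeasure L ν V M) (hw : 0 ≤ w)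
      (ha : 0 ≤ a) (hab : a < b) (hb : b ≤ L) :
      StepMeasure L (ν + ENNReal.ofReal w • (lebIcc L).restrict (subIoo L a b)) (V + w)
        (M + w * (b - a))

namespace StepMeasure

variable {ν ν' : Measure (Icc (0 : ℝ) L)} {V V' M M' : ℝ}

theorem single {w a b : ℝ} (hw : 0 ≤ w) (ha : 0 ≤ a) (hab : a < b) (hb : b ≤ L) :
    StepMeasure L (ENNReal.ofReal w • (lebIcc L).restrict (subIoo L a b)) w (w * (b - a)) := by
  simpa using StepMeasure.zero.add hw ha hab hb

theorem sum (h : StepMeasure L ν V M) (h' : StepMeasure L ν' V' M') :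
    StepMeasure L (ν + ν') (V + V') (M + M') := by
  induction h' with
  | zero => simpa using h
  | add _ hw ha hab hb ih =>
    have := ih.add hw ha hab hb
    simpa only [add_assoc] using this

theorem nonneg (h : StepMeasure L ν V M) : 0 ≤ V ∧ 0 ≤ M := by
  induction h with
  | zero => simp
  | add _ hw ha hab hb ih =>
    exact ⟨add_nonneg ih.1 hw, add_nonneg ih.2 (mul_nonneg hw (sub_nonneg.2 hab.le))⟩

theorem le_smul (h : StepMeasure L ν V M) : ν ≤ ENNReal.ofReal V • lebIcc L := by
  induction h with
  | zero => simp
  | add h hw ha hab hb ih =>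
    rw [ENNReal.ofReal_add h.nonneg.1 hw, add_smul]
    exact add_le_add ih (by gcongr; exact Measure.restrict_le_self)

/-- Intervals shorter than `δ` carry mass at most `δ * V` altogether. On a longer one the complement
of `A` has length at least `c`, hence takes at least the proportion `c / L` of the mass. So a set
missing a definite part of every long interval misses much of the mass. -/
theorem mul_mass_le (h : StepMeasure L ν V M) {A : Set (Icc (0 : ℝ) L)} (hA : MeasurableSet A)
    {c δ : ℝ} (hc : 0 ≤ c)
    (hδ : 0 ≤ δ)
    (hlong : ∀ a b, 0 ≤ a → b ≤ L → δ ≤ b - a → c ≤ (lebIcc L).real (subIoo L a b \ A)) :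
    c * M ≤ L * ν.real Aᶜ + c * δ * V := by
  have hfin : IsFiniteMeasure ν := ⟨(h.le_smul univ).trans_lt (by
    rw [Measure.smul_apply, smul_eq_mul]
    exact ENNReal.mul_lt_top ENNReal.ofReal_lt_top (measure_lt_top _ _))⟩
  induction h with
  | zero => simp
  | @add ν V M w a b h hw ha hab hb ih =>
    have hfin' : IsFiniteMeasure ν := ⟨(h.le_smul univ).trans_lt (by
      rw [Measure.smul_apply, smul_eq_mul]
      exact ENNReal.mul_lt_top ENNReal.ofReal_lt_top (measure_lt_top _ _))⟩
    have hfin2 : IsFiniteMeasure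
      (ENNReal.ofReal w • (lebIcc L).restrict (subIoo L a b)) := ⟨by
        rw [Measure.smul_apply, smul_eq_mul]
        exact ENNReal.mul_lt_top ENNReal.ofReal_lt_top (measure_lt_top _ _)⟩
    have ih := ih hfin'
    rw [measureReal_add_apply, measureReal_ennreal_smul_apply, ENNReal.toReal_ofReal hw,
      measureReal_restrict_apply hA.compl, inter_comm, ← sdiff_eq]
    have key : c * (b - a) ≤ L * (lebIcc L).real (subIoo L a b \ A) + c * δ := by
      rcases le_or_gt δ (b - a) with h1 | h1
      · have h2 := hlong a b ha hb h1
        have hr : 0 ≤ (lebIcc L).real (subIoo L a b \ A) := measureReal_nonneg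
        nlinarith [mul_le_mul_of_nonneg_left h2 (show 0 ≤ L by linarith), mul_nonneg hc hδ,
          mul_le_mul_of_nonneg_left (show b - a ≤ L by linarith) hc]
      · have hr : 0 ≤ (lebIcc L).real (subIoo L a b \ A) := measureReal_nonneg
        have hL : 0 ≤ L := by linarith
        nlinarith [mul_nonneg hL hr]
    nlinarith [mul_le_mul_of_nonneg_left key hw]

end StepMeasure

end StepMeasures

/-! ### Push-forward of step measures and the Lasota–Yorke inequality. -/

section LasotaYorke

open scoped ENNReal
variable {L : ℝ} {F : Icc (0 : ℝ) L → Icc (0 : ℝ) L}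

theorem lebIcc_restrict_subIoo_split {a b d : ℝ} (had : a < d) (hdb : d < b) :
    (lebIcc L).restrict (subIoo L a b) =
      (lebIcc L).restrict (subIoo L a d) + (lebIcc L).restrict (subIoo L d b) := by
  rw [← Measure.restrict_union _ (measurableSet_subIoo L d b)]
  · refine Measure.restrict_congr_set ?_
    have h0 : ∀ᵐ x : Icc (0 : ℝ) L ∂lebIcc L, (x : ℝ) ≠ d := by
      by_cases hd : d ∈ Icc (0 : ℝ) L
      · filter_upwards [compl_mem_ae_iff.2 (lebIcc_singleton ⟨d, hd⟩)] with x hx h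
        exact hx (Subtype.ext h)
      · exact Eventually.of_forall fun x h => hd (h ▸ x.2)
    filter_upwards [h0] with x hx
    refine propext (Iff.trans mem_subIoo ?_)
    change _ ↔ (x ∈ subIoo L a d ∨ x ∈ subIoo L d b)
    rw [mem_subIoo, mem_subIoo]
    constructor
    · rintro ⟨h1, h2⟩
      rcases lt_or_gt_of_ne hx with h | h
      · exact Or.inl ⟨h1, h⟩
      · exact Or.inr ⟨h, h2⟩
    · rintro (⟨h1, h2⟩ | ⟨h1, h2⟩)
      · exact ⟨h1, h2.trans hdb⟩
      · exact ⟨had.trans h1, h2⟩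
  · rw [Set.disjoint_left]
    rintro x ⟨_, h1⟩ ⟨h2, _⟩
    exact lt_asymm h1 h2

/-- `F` is affine with slope at least `Λ` in absolute value on every interval without cut points
(elements of `D`). -/
def PiecewiseExpanding (F : Icc (0 : ℝ) L → Icc (0 : ℝ) L) (D : Finset ℝ) (Λ : ℝ) : Prop :=
  ∀ a b, 0 ≤ a → a < b → b ≤ L → (∀ d ∈ D, d ∉ Ioo a b) →
    ∃ s t, Λ ≤ |s| ∧ AffineOnIoo F a b s t

theorem exists_gap (D : Finset ℝ) : ∃ δ > 0, ∀ d ∈ D, ∀ d' ∈ D, d ≠ d' → δ ≤ |d - d'| := by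
  classical
  by_cases h : ((D ×ˢ D).filter (fun p => p.1 ≠ p.2)).Nonempty
  · obtain ⟨p, hp, hmin⟩ := Finset.exists_min_image _ (fun p : ℝ × ℝ => |p.1 - p.2|) h
    refine ⟨|p.1 - p.2|, abs_pos.2 (sub_ne_zero.2 (Finset.mem_filter.1 hp).2), ?_⟩
    intro d hd d' hd' hne
    exact hmin (d, d') (Finset.mem_filter.2 ⟨Finset.mem_product.2 ⟨hd, hd'⟩, hne⟩)
  · refine ⟨1, one_pos, fun d hd d' hd' hne => absurd ?_ h⟩
    exact ⟨(d, d'), Finset.mem_filter.2 ⟨Finset.mem_product.2 ⟨hd, hd'⟩, hne⟩⟩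

open Classical in
/-- A finite set has at most `1 + K * (b - a)` points between `a` and `b`. -/
theorem exists_card_filter_Ioo_le (D : Finset ℝ) : ∃ K : ℝ, 0 ≤ K ∧ ∀ a b, a < b →
    ((D.filter (· ∈ Ioo a b)).card : ℝ) ≤ 1 + K * (b - a) := by
  -- An interval shorter than the least gap contains at most one point of `D`; for a longer one the
  -- length term already pays for all of `D`.
  obtain ⟨δ, hδ, hgap⟩ := exists_gap D
  refine ⟨D.card / δ, by positivity, fun a b hab => ?_⟩
  rcases lt_or_ge (b - a) δ with h | h
  · have : (D.filter (· ∈ Ioo a b)).card ≤ 1 := by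
      rw [Finset.card_le_one]
      intro x hx y hy
      rw [Finset.mem_filter] at hx hy
      by_contra hne
      have h1 := hgap x hx.1 y hy.1 hne
      have h2 : |x - y| < b - a := by
        rw [abs_lt]
        constructor <;> linarith [hx.2.1, hx.2.2, hy.2.1, hy.2.2]
      linarith
    have h3 : ((D.filter (· ∈ Ioo a b)).card : ℝ) ≤ 1 := by exact_mod_cast this
    have : 0 ≤ D.card / δ * (b - a) := mul_nonneg (by positivity) (sub_nonneg.2 hab.le)
    linarith
  · have h1 : ((D.filter (· ∈ Ioo a b)).card : ℝ) ≤ D.card := by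
      exact_mod_cast Finset.card_filter_le _ _
    have h2 : (D.card : ℝ) ≤ D.card / δ * (b - a) := by
      rw [div_mul_eq_mul_div, le_div_iff₀ hδ]
      gcongr
    linarith

open Classical in
-- At most `k` cut points leave at most `k + 1` pieces, and each piece is mapped onto an interval of
-- weight `w / |s| ≤ w / Λ` without change of mass.
theorem PiecewiseExpanding.stepMeasure_map_single {D : Finset ℝ} {Λ : ℝ}
    (hP : PiecewiseExpanding F D Λ) (hF : Measurable F) (hΛ : 0 < Λ) {w : ℝ} (hw : 0 ≤ w) (k : ℕ) :
    ∀ a b, 0 ≤ a → a < b → b ≤ L → (D.filter (· ∈ Ioo a b)).card ≤ k →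
      ∃ V, V ≤ (k + 1) * (w / Λ) ∧ StepMeasure L
        ((ENNReal.ofReal w • (lebIcc L).restrict (subIoo L a b)).map F) V (w * (b - a)) := by
  induction k using Nat.strong_induction_on with
  | _ k ih =>
  intro a b ha hab hb hk
  by_cases hD : ∀ d ∈ D, d ∉ Ioo a b
  · obtain ⟨s, t, hs, haff⟩ := hP a b ha hab hb hD
    have hs0 : 0 < |s| := hΛ.trans_le hs
    refine ⟨w * |s|⁻¹, ?_, ?_⟩
    · calc w * |s|⁻¹ ≤ w * Λ⁻¹ := by gcongr
        _ = 1 * (w / Λ) := by rw [one_mul, div_eq_mul_inv]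
        _ ≤ (k + 1) * (w / Λ) := by gcongr; linarith [k.cast_nonneg (α := ℝ)]
    · have h1 := haff.mem_Icc ha hab hb (left_mem_Icc.2 hab.le)
      have h2 := haff.mem_Icc ha hab hb (right_mem_Icc.2 hab.le)
      have hlen := max_sub_min_affine (s := s) (t := t) hab
      have hstep := StepMeasure.single (L := L) (w := w * |s|⁻¹) (by positivity)
        (le_min h1.1 h2.1) (show min (s * a + t) (s * b + t) < max (s * a + t) (s * b + t) by
          have : 0 < |s| * (b - a) := mul_pos hs0 (sub_pos.2 hab)
          linarith) (max_le h1.2 h2.2)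
      rw [hlen] at hstep
      rw [Measure.map_smul, haff.map_restrict hF ha hab hb (abs_pos.1 hs0), smul_smul,
        ← ENNReal.ofReal_mul hw]
      convert hstep using 1
      field_simp
  · push Not at hD
    obtain ⟨d, hd, had, hdb⟩ := hD
    have hcard : (D.filter (· ∈ Ioo a d)).card + (D.filter (· ∈ Ioo d b)).card + 1 ≤
        (D.filter (· ∈ Ioo a b)).card := by
      have hdis : Disjoint (D.filter (· ∈ Ioo a d)) (D.filter (· ∈ Ioo d b)) := by
        rw [Finset.disjoint_left]
        intro x hx hy
        exact lt_asymm (Finset.mem_filter.1 hx).2.2 (Finset.mem_filter.1 hy).2.1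
      rw [← Finset.card_union_of_disjoint hdis]
      have hnot : d ∉ D.filter (· ∈ Ioo a d) ∪ D.filter (· ∈ Ioo d b) := by
        simp
      rw [← Finset.card_insert_of_notMem hnot]
      refine Finset.card_le_card ?_
      intro x hx
      rw [Finset.mem_insert, Finset.mem_union, Finset.mem_filter, Finset.mem_filter] at hx
      rw [Finset.mem_filter]
      rcases hx with rfl | ⟨h1, h2⟩ | ⟨h1, h2⟩
      · exact ⟨hd, had, hdb⟩
      · exact ⟨h1, h2.1, h2.2.trans hdb⟩
      · exact ⟨h1, had.trans h2.1, h2.2⟩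
    obtain ⟨V₁, hV₁, h₁⟩ := ih _ (by lia) a d ha had (hdb.le.trans hb) le_rfl
    obtain ⟨V₂, hV₂, h₂⟩ := ih _ (by lia) d b (ha.trans had.le) hdb hb le_rfl
    refine ⟨V₁ + V₂, ?_, ?_⟩
    · have h3 : ((D.filter (· ∈ Ioo a d)).card : ℝ) + (D.filter (· ∈ Ioo d b)).card + 1 ≤ k := by
        exact_mod_cast hcard.trans hk
      have h4 : 0 ≤ w / Λ := by positivity
      nlinarith
    · have := h₁.sum h₂
      rw [lebIcc_restrict_subIoo_split had hdb, smul_add, Measure.map_add _ _ hF]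
      convert this using 1
      ring

/-- The **Lasota–Yorke inequality** for step measures. -/
theorem PiecewiseExpanding.exists_lasotaYorke {D : Finset ℝ} {Λ : ℝ}
    (hP : PiecewiseExpanding F D Λ) (hF : Measurable F) (hΛ : 0 < Λ) :
    ∃ K : ℝ, 0 ≤ K ∧ ∀ ν V M, StepMeasure L ν V M →
      ∃ V', StepMeasure L (ν.map F) V' M ∧ V' ≤ 2 / Λ * V + K * M := by
  classical
  obtain ⟨K, hK, hcard⟩ := exists_card_filter_Ioo_le D
  refine ⟨K / Λ, by positivity, fun ν V M h => ?_⟩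
  induction h with
  | zero => exact ⟨0, by simpa using StepMeasure.zero, by simp⟩
  | @add ν V M w a b h hw ha hab hb ih =>
    obtain ⟨V', h', hV'⟩ := ih
    obtain ⟨V₂, hV₂, h₂⟩ := hP.stepMeasure_map_single hF hΛ hw _ a b ha hab hb le_rfl
    refine ⟨V' + V₂, ?_, ?_⟩
    · rw [Measure.map_add _ _ hF]
      exact h'.sum h₂
    · have h3 := hcard a b hab
      -- The constant `2` counts the pieces created by a single cut. The excess over it is
      -- proportional to `b - a`, so it is charged to the mass and not to the weight.
      have h4 : V₂ ≤ (2 + K * (b - a)) * (w / Λ) :=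
        hV₂.trans (mul_le_mul_of_nonneg_right (by linarith) (by positivity))
      calc V' + V₂ ≤ (2 / Λ * V + K / Λ * M) + (2 + K * (b - a)) * (w / Λ) := add_le_add hV' h4
        _ = 2 / Λ * (V + w) + K / Λ * (M + w * (b - a)) := by ring

end LasotaYorke

/-! ### Iterates: uniform domination, and cells filled by forward images. -/

section ExpandingIterates

open scoped ENNReal
variable {L : ℝ} {F : Icc (0 : ℝ) L → Icc (0 : ℝ) L}

/-- Between consecutive cut points the map is affine with nonzero slope, hence injective. A preimage
off `D` is therefore determined by the number of cut points below it; `0, L ∈ D` ensures that it has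
a cut point on either side. -/
theorem PiecewiseExpanding.finite_preimage {D : Finset ℝ} {Λ : ℝ}
    (hP : PiecewiseExpanding F D Λ) (hΛ : 0 < Λ) (h0 : 0 ∈ D) (hL : L ∈ D) (d : ℝ) :
    {x : ℝ | x ∉ D ∧ ∃ hx : x ∈ Icc 0 L, (F ⟨x, hx⟩ : ℝ) = d}.Finite := by
  classical
  refine Set.Finite.of_injOn (f := fun x => (D.filter (· < x)).card)
    (t := (Finset.range (D.card + 1) : Set ℕ)) ?_ ?_ (Finset.finite_toSet _)
  · intro x _
    simpa [Nat.lt_succ_iff] using Finset.card_filter_le D (· < x)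
  · have key : ∀ x y : ℝ, x ∉ D → y ∉ D → ∀ (hx : x ∈ Icc 0 L) (hy : y ∈ Icc 0 L),
        (F ⟨x, hx⟩ : ℝ) = d → (F ⟨y, hy⟩ : ℝ) = d →
        (D.filter (· < x)).card = (D.filter (· < y)).card → ¬ x < y := by
      intro x y hxD hyD hx hy hFx hFy hcard hxy
      have heq : D.filter (· < x) = D.filter (· < y) := by
        refine Finset.eq_of_subset_of_card_le (fun e he => ?_) hcard.ge
        rw [Finset.mem_filter] at he ⊢
        exact ⟨he.1, he.2.trans hxy⟩
      have hx0 : 0 < x := lt_of_le_of_ne hx.1 fun h => hxD (h ▸ h0)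
      have hyL : y < L := lt_of_le_of_ne hy.2 fun h => hyD (h ▸ hL)
      have hn1 : (D.filter (· < x)).Nonempty := ⟨0, Finset.mem_filter.2 ⟨h0, hx0⟩⟩
      have hn2 : (D.filter (y < ·)).Nonempty := ⟨L, Finset.mem_filter.2 ⟨hL, hyL⟩⟩
      set a := (D.filter (· < x)).max' hn1 with ha
      set b := (D.filter (y < ·)).min' hn2 with hb
      have hax : a < x := (Finset.mem_filter.1 (Finset.max'_mem _ hn1)).2
      have hyb : y < b := (Finset.mem_filter.1 (Finset.min'_mem _ hn2)).2
      have ha0 : 0 ≤ a := Finset.le_max' _ _ (Finset.mem_filter.2 ⟨h0, hx0⟩)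
      have hbL : b ≤ L := Finset.min'_le _ _ (Finset.mem_filter.2 ⟨hL, hyL⟩)
      obtain ⟨s, t, hs, haff⟩ := hP a b ha0 (hax.trans (hxy.trans hyb)) hbL (by
        rintro e he ⟨hae, heb⟩
        rcases lt_or_ge e x with h | h
        · exact not_lt.2 (Finset.le_max' _ e (Finset.mem_filter.2 ⟨he, h⟩)) hae
        rcases lt_trichotomy e y with h' | rfl | h'
        · have : e ∈ D.filter (· < x) := by
            rw [heq]; exact Finset.mem_filter.2 ⟨he, h'⟩
          exact not_lt.2 h (Finset.mem_filter.1 this).2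
        · exact hyD he
        · exact not_lt.2 (Finset.min'_le _ e (Finset.mem_filter.2 ⟨he, h'⟩)) heb)
      have h1 := haff ⟨x, hx⟩ hax (hxy.trans hyb)
      have h2 := haff ⟨y, hy⟩ (hax.trans hxy) hyb
      rw [hFx] at h1
      rw [hFy, h1] at h2
      have hs0 : s ≠ 0 := abs_pos.1 (hΛ.trans_le hs)
      have : x = y := mul_left_cancel₀ hs0 (by simpa using h2)
      exact hxy.ne this
    rintro x ⟨hxD, hx, hFx⟩ y ⟨hyD, hy, hFy⟩ hxy
    rcases lt_trichotomy x y with h | h | h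
    · exact absurd h (key x y hxD hyD hx hy hFx hFy hxy)
    · exact h
    · exact absurd h (key y x hyD hxD hy hx hFy hFx hxy.symm)

theorem PiecewiseExpanding.mono {D D' : Finset ℝ} {Λ : ℝ} (hP : PiecewiseExpanding F D Λ)
    (h : D ⊆ D') : PiecewiseExpanding F D' Λ :=
  fun a b ha hab hb hD => hP a b ha hab hb fun d hd => hD d (h hd)

/-- The cut points of `G ∘ F` are those of `F`, the ends of `[0, L]`, and the finitely many
preimages of the cut points of `G`. -/
theorem PiecewiseExpanding.comp {G : Icc (0 : ℝ) L → Icc (0 : ℝ) L} {D D' : Finset ℝ}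
    {Λ Λ' : ℝ} (hG : PiecewiseExpanding G D' Λ') (hP : PiecewiseExpanding F D Λ)
    (hΛ : 0 < Λ) : ∃ D'', PiecewiseExpanding (G ∘ F) D'' (Λ' * Λ) := by
  classical
  let D₀ := insert 0 (insert L D)
  have hP₀ : PiecewiseExpanding F D₀ Λ := hP.mono fun x hx => by simp [D₀, hx]
  have hfin := fun d => hP₀.finite_preimage hΛ (by simp [D₀]) (by simp [D₀]) d
  refine ⟨D₀ ∪ D'.biUnion fun d => (hfin d).toFinset, fun a b ha hab hb hD => ?_⟩
  have hD0 : ∀ d ∈ D₀, d ∉ Ioo a b := fun d hd => hD d (Finset.mem_union_left _ hd)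
  obtain ⟨s, t, hs, haff⟩ := hP₀ a b ha hab hb hD0
  have hs0 : 0 < |s| := hΛ.trans_le hs
  have h1 := haff.mem_Icc ha hab hb (left_mem_Icc.2 hab.le)
  have h2 := haff.mem_Icc ha hab hb (right_mem_Icc.2 hab.le)
  have hlen := max_sub_min_affine (s := s) (t := t) hab
  obtain ⟨s', t', hs', haff'⟩ := hG (min (s * a + t) (s * b + t)) (max (s * a + t) (s * b + t))
    (le_min h1.1 h2.1) (by have : 0 < |s| * (b - a) := mul_pos hs0 (sub_pos.2 hab); linarith)
    (max_le h1.2 h2.2) (by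
      intro d hd hdI
      have hsx : s * ((d - t) / s) + t = d := by
        have := abs_pos.1 hs0
        field_simp
        ring
      rw [← hsx, mem_Ioo_min_max_iff hab (abs_pos.1 hs0)] at hdI
      refine hD ((d - t) / s) (Finset.mem_union_right _ (Finset.mem_biUnion.2 ⟨d, hd, ?_⟩)) hdI
      rw [Set.Finite.mem_toFinset]
      refine ⟨fun h => hD0 _ h hdI, ⟨ha.trans hdI.1.le, hdI.2.le.trans hb⟩, ?_⟩
      rw [haff _ hdI.1 hdI.2]
      exact hsx)
  refine ⟨s' * s, s' * t + t', ?_, fun x hax hxb => ?_⟩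
  · rw [abs_mul]
    exact mul_le_mul hs' hs hΛ.le (abs_nonneg _)
  · have hm := (mem_Ioo_min_max_iff (s := s) (t := t) hab (abs_pos.1 hs0)).2 ⟨hax, hxb⟩
    rw [← haff x hax hxb] at hm
    rw [Function.comp_apply, haff' (F x) hm.1 hm.2, haff x hax hxb]
    ring

theorem PiecewiseExpanding.iterate {D : Finset ℝ} {Λ : ℝ} (hP : PiecewiseExpanding F D Λ)
    (hΛ : 0 < Λ) (n : ℕ) : ∃ D', PiecewiseExpanding F^[n] D' (Λ ^ n) := by
  induction n with
  | zero => exact ⟨∅, fun a b _ _ _ _ => ⟨1, 0, by simp, fun x _ _ => by simp⟩⟩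
  | succ n ih =>
    obtain ⟨D', hD'⟩ := ih
    rw [Function.iterate_succ, pow_succ]
    exact hD'.comp hP hΛ

theorem PiecewiseExpanding.exists_iterate_bound {D : Finset ℝ} {Λ : ℝ}
    (hP : PiecewiseExpanding F D Λ) (hF : Measurable F) (hΛ : 1 < Λ) :
    ∃ N : ℕ, 0 < N ∧ ∃ K : ℝ, 0 ≤ K ∧ ∀ q ν V M, StepMeasure L ν V M →
      ∃ V', StepMeasure L (ν.map F^[N * q]) V' M ∧ V' ≤ V / 2 ^ q + K * M := by
  -- With `Λ ^ N > 4` the factor `2 / Λ ^ N` is at most `1 / 2`; summing the geometric series turns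
  -- the additive constant `K` into `2 * K`.
  obtain ⟨N, hN⟩ := pow_unbounded_of_one_lt 4 hΛ
  have hN0 : 0 < N := Nat.pos_of_ne_zero fun h => by rw [h] at hN; norm_num at hN
  have hΛN : 0 < Λ ^ N := by linarith
  obtain ⟨D', hD'⟩ := hP.iterate (zero_lt_one.trans hΛ) N
  obtain ⟨K, hK, hLY⟩ := hD'.exists_lasotaYorke (hF.iterate N) hΛN
  refine ⟨N, hN0, 2 * K, by positivity, fun q ν V M h => ?_⟩
  induction q with
  | zero => exact ⟨V, by simpa using h, by simp; nlinarith [h.nonneg.2]⟩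
  | succ q ih =>
    obtain ⟨V₁, h₁, hV₁⟩ := ih
    obtain ⟨V₂, h₂, hV₂⟩ := hLY _ _ _ h₁
    refine ⟨V₂, ?_, ?_⟩
    · rw [Measure.map_map (hF.iterate _) (hF.iterate _), ← Function.iterate_add] at h₂
      rwa [mul_add, mul_one, add_comm]
    · have h3 : 2 / Λ ^ N ≤ 1 / 2 := by
        rw [div_le_div_iff₀ hΛN two_pos]; linarith
      calc V₂ ≤ 2 / Λ ^ N * V₁ + K * M := hV₂
        _ ≤ 1 / 2 * V₁ + K * M := by gcongr; exact h₁.nonneg.1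
        _ ≤ 1 / 2 * (V / 2 ^ q + 2 * K * M) + K * M := by gcongr
        _ = V / 2 ^ (q + 1) + 2 * K * M := by rw [pow_succ]; field_simp; ring

theorem subIoo_univ_ae (L : ℝ) : subIoo L 0 L =ᵐ[lebIcc L] univ := by
  rcases lt_or_ge L 0 with h | h
  · have : IsEmpty (Icc (0 : ℝ) L) := by
      rw [Set.isEmpty_coe_sort, Icc_eq_empty (not_le.2 h)]
    exact Eventually.of_forall fun x => (IsEmpty.false x).elim
  · rw [ae_eq_univ_iff_measure_eq (measurableSet_subIoo _ _ _).nullMeasurableSet,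
      lebIcc_subIoo le_rfl le_rfl, lebIcc_univ, sub_zero]

theorem stepMeasure_lebIcc (hL : 0 < L) : StepMeasure L (lebIcc L) 1 L := by
  have := StepMeasure.single (L := L) zero_le_one le_rfl hL le_rfl
  rw [Measure.restrict_congr_set (subIoo_univ_ae L), Measure.restrict_univ] at this
  simpa using this

theorem PiecewiseExpanding.map_iterate_le {D : Finset ℝ} {Λ : ℝ}
    (hP : PiecewiseExpanding F D Λ) (hF : Measurable F) (hΛ : 1 < Λ) (hL : 0 < L) :
    ∃ C : ℝ≥0∞, C ≠ ∞ ∧ ∀ n, (lebIcc L).map F^[n] ≤ C • lebIcc L := by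
  obtain ⟨N, hN, K, hK, hbound⟩ := hP.exists_iterate_bound hF hΛ
  obtain ⟨K₁, hK₁, hLY⟩ := hP.exists_lasotaYorke hF (zero_lt_one.trans hΛ)
  have hr : ∀ r : ℕ, ∃ V, StepMeasure L ((lebIcc L).map F^[r]) V L := fun r => by
    induction r with
    | zero => exact ⟨1, by simpa using stepMeasure_lebIcc hL⟩
    | succ r ih =>
      obtain ⟨V, hV⟩ := ih
      obtain ⟨V', hV', -⟩ := hLY _ _ _ hV
      rw [Measure.map_map hF (hF.iterate _), ← Function.iterate_succ'] at hV'
      exact ⟨V', hV'⟩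
  choose V hV using hr
  refine ⟨ENNReal.ofReal (∑ r ∈ Finset.range N, V r + K * L), ENNReal.ofReal_ne_top, fun n => ?_⟩
  -- Only `N` starting weights occur, one for each remainder of `n` modulo `N`, and the bound
  -- contracts from there.
  obtain ⟨V', hV', hle⟩ := hbound (n / N) _ _ _ (hV (n % N))
  rw [Measure.map_map (hF.iterate _) (hF.iterate _), ← Function.iterate_add, Nat.div_add_mod]
    at hV'
  refine hV'.le_smul.trans ?_
  have h1 : V (n % N) ≤ ∑ r ∈ Finset.range N, V r :=
    Finset.single_le_sum (fun r _ => (hV r).nonneg.1) (Finset.mem_range.2 (Nat.mod_lt _ hN))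
  have h2 : V (n % N) / 2 ^ (n / N) ≤ V (n % N) :=
    div_le_self (hV _).nonneg.1 (one_le_pow₀ one_le_two)
  have h3 : V' ≤ ∑ r ∈ Finset.range N, V r + K * L := by linarith
  exact Measure.le_iff.2 fun A _ => by
    rw [Measure.smul_apply, Measure.smul_apply, smul_eq_mul, smul_eq_mul]
    exact mul_le_mul' (ENNReal.ofReal_le_ofReal h3) le_rfl

theorem exists_subIoo_diff_le {A : Set (Icc (0 : ℝ) L)} (hA : MeasurableSet A)
    (hA0 : lebIcc L A ≠ 0) {ε : ℝ} (hε : 0 < ε) :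
    ∃ a b, 0 ≤ a ∧ a < b ∧ b ≤ L ∧ (lebIcc L).real (subIoo L a b \ A) ≤ ε * (b - a) := by
  set s : Set ℝ := Subtype.val '' A with hs
  have hsm : MeasurableSet s :=
    (MeasurableEmbedding.subtype_coe measurableSet_Icc).measurableSet_image.2 hA
  have hpos : volume (s ∩ Ioo 0 L) ≠ 0 := by
    rw [inter_comm, ← lebIcc_subIoo_inter, measure_congr
      (show (subIoo L 0 L ∩ A : Set _) =ᵐ[lebIcc L] (univ ∩ A : Set _) from
        (subIoo_univ_ae L).inter EventuallyEq.rfl), univ_inter]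
    exact hA0
  -- The interval is a small ball around a Lebesgue density point of `A` inside `(0, L)`.
  have hdens := Besicovitch.ae_tendsto_measure_inter_div (volume : Measure ℝ) s
  rw [ae_restrict_iff' hsm] at hdens
  obtain ⟨x, ⟨hxs, hx0, hxL⟩, hx⟩ : ∃ x ∈ s ∩ Ioo 0 L, x ∈ s → Tendsto (fun r =>
      volume (s ∩ Metric.closedBall x r) / volume (Metric.closedBall x r)) (𝓝[>] 0) (𝓝 1) := by
    by_contra! h
    refine hpos (measure_mono_null (fun x hx => ?_) hdens)
    exact fun h' => (h x hx).2 (h' (h x hx).1)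
  have hx := hx hxs
  have h1 : ∀ᶠ r in 𝓝[>] (0 : ℝ), ENNReal.ofReal (1 - ε) <
      volume (s ∩ Metric.closedBall x r) / volume (Metric.closedBall x r) :=
    hx.eventually_const_lt (by rw [ENNReal.ofReal_lt_one]; linarith)
  have h2 : ∀ᶠ r in 𝓝[>] (0 : ℝ), r < min x (L - x) :=
    (eventually_lt_nhds (lt_min hx0 (sub_pos.2 hxL))).filter_mono nhdsWithin_le_nhds
  obtain ⟨r, hr1, hr2, hr0⟩ := (h1.and (h2.and self_mem_nhdsWithin)).exists
  have hr0 : 0 < r := hr0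
  have hrx := hr2.trans_le (min_le_left _ _)
  have hrL := hr2.trans_le (min_le_right _ _)
  refine ⟨x - r, x + r, by linarith, by linarith, by linarith, ?_⟩
  have hball : Metric.closedBall x r =ᵐ[volume] Ioo (x - r) (x + r) := by
    rw [Real.closedBall_eq_Icc]; exact Ioo_ae_eq_Icc.symm
  rw [measure_congr hball, measure_congr (EventuallyEq.rfl.inter hball), Real.volume_Ioo,
    inter_comm, ← lebIcc_subIoo_inter, ENNReal.lt_div_iff_mul_lt (by simp) (by simp)] at hr1
  have h3 : (1 - ε) * (x + r - (x - r)) ≤ (lebIcc L).real (subIoo L (x - r) (x + r) ∩ A) := by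
    rw [measureReal_def, ← ENNReal.ofReal_le_iff_le_toReal (measure_ne_top _ _)]
    rcases le_total 0 (1 - ε) with h | h
    · rw [ENNReal.ofReal_mul h]; exact hr1.le
    · rw [ENNReal.ofReal_of_nonpos (mul_nonpos_of_nonpos_of_nonneg h (by linarith))]
      exact zero_le
  have h4 := measureReal_inter_add_sdiff (μ := lebIcc L) (s := subIoo L (x - r) (x + r)) hA
  have h5 : (lebIcc L).real (subIoo L (x - r) (x + r)) = x + r - (x - r) := by
    rw [measureReal_def, lebIcc_subIoo (by linarith) (by linarith),
      ENNReal.toReal_ofReal (by linarith)]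
  rw [h5] at h4
  linarith

/-- There are finitely many intervals such that the forward images of any set of positive
measure fill one of them up to a set of arbitrarily small measure. -/
theorem PiecewiseExpanding.exists_cells {D : Finset ℝ} {Λ : ℝ}
    (hP : PiecewiseExpanding F D Λ) (hF : Measurable F) (hΛ : 1 < Λ) (hL : 0 < L) :
    ∃ G : Finset (ℝ × ℝ), (∀ p ∈ G, 0 ≤ p.1 ∧ p.1 < p.2 ∧ p.2 ≤ L) ∧
      ∀ (A : Set (Icc (0 : ℝ) L)) (B : ℕ → Set (Icc (0 : ℝ) L)), MeasurableSet A →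
        (∀ n, MeasurableSet (B n)) → lebIcc L A ≠ 0 → (∀ n, A ≤ᵐ[lebIcc L] F^[n] ⁻¹' B n) →
        ∀ c > 0, ∃ n, ∃ p ∈ G, (lebIcc L).real (subIoo L p.1 p.2 \ B n) < c := by
  classical
  obtain ⟨N, hN, K, hK, hbound⟩ := hP.exists_iterate_bound hF hΛ
  have hC : 0 < K + 1 := by linarith
  -- Once `V ≤ (K + 1) * (b - a)`, intervals shorter than `δ` carry at most half of the mass `b -
  -- a`. Every interval of length `δ` contains a cell of the grid of step `η = δ / 2`, and these
  -- cells form `G`.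
  set δ : ℝ := 1 / (2 * (K + 1)) with hδ
  have hδ0 : 0 < δ := by positivity
  set η : ℝ := δ / 2 with hη
  have hη0 : 0 < η := by positivity
  refine ⟨((Finset.range (⌊L / η⌋₊ + 1)).image fun j : ℕ => ((j * η, (j + 1) * η) : ℝ × ℝ)).filter
    fun p => p.2 ≤ L, ?_, ?_⟩
  · intro p hp
    obtain ⟨hp1, hp2⟩ := Finset.mem_filter.1 hp
    obtain ⟨j, -, rfl⟩ := Finset.mem_image.1 hp1
    refine ⟨by positivity, ?_, hp2⟩
    simp only
    nlinarith
  · intro A B hA hB hA0 hAB c hc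
    obtain ⟨a, b, ha, hab, hb, hJ⟩ := exists_subIoo_diff_le hA hA0
      (show 0 < c / (4 * L) by positivity)
    have hJ0 : 0 < b - a := sub_pos.2 hab
    -- Enough iterations for the initial weight `1` to decay below the length of the interval.
    obtain ⟨q, hq⟩ := exists_pow_lt_of_lt_one hJ0 (one_half_lt_one (α := ℝ))
    obtain ⟨V, hV, hVle⟩ := hbound q _ _ _ (StepMeasure.single (L := L) zero_le_one ha hab hb)
    rw [ENNReal.ofReal_one, one_smul, one_mul] at hV
    have hVle' : V ≤ (K + 1) * (b - a) := by
      have : (1 : ℝ) / 2 ^ q < b - a := by rwa [one_div_pow] at hq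
      linarith
    set n := N * q
    have hbad : (((lebIcc L).restrict (subIoo L a b)).map F^[n]).real (B n)ᶜ ≤
        c / (4 * L) * (b - a) := by
      refine le_trans ?_ hJ
      rw [map_measureReal_apply (hF.iterate n) (hB n).compl,
        measureReal_restrict_apply ((hF.iterate n) (hB n).compl), inter_comm, preimage_compl,
        ← sdiff_eq]
      refine ENNReal.toReal_mono (measure_ne_top _ _) (measure_mono_ae ?_)
      filter_upwards [hAB n] with x hx h
      exact ⟨h.1, fun hxA => h.2 (hx hxA)⟩
    by_contra! hno
    -- If every cell missed `B n` by `c`, the bad mass would be at least `c * (b - a) / (2 * L)`,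
    -- twice what the choice of density allows.
    have hmass := hV.mul_mass_le (hB n) hc.le hδ0.le (fun u v hu hv huv => by
      set j := ⌈u / η⌉₊ with hj
      have h1 : u ≤ j * η := by
        have := Nat.le_ceil (u / η)
        rwa [div_le_iff₀ hη0] at this
      have h2 : j * η < u + η := by
        have := Nat.ceil_lt_add_one (show 0 ≤ u / η by positivity)
        calc (j : ℝ) * η < (u / η + 1) * η := by gcongr
          _ = u + η := by field_simp
      have h3 : (j + 1) * η ≤ v := by linarith
      have hmem := hno n (j * η, (j + 1) * η) (Finset.mem_filter.2
        ⟨Finset.mem_image.2 ⟨j, Finset.mem_range.2 (Nat.lt_succ_of_le (Nat.le_floor ?_)), rfl⟩,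
          h3.trans hv⟩)
      · refine hmem.trans (measureReal_mono ?_ (measure_ne_top _ _))
        rintro x ⟨⟨hx1, hx2⟩, hxB⟩
        exact ⟨⟨h1.trans_lt hx1, hx2.trans_le h3⟩, hxB⟩
      · rw [le_div_iff₀ hη0]
        linarith)
    have h4 : L * (c / (4 * L) * (b - a)) = c * (b - a) / 4 := by field_simp
    have h5 : c * δ * V ≤ c * (b - a) / 2 := by
      calc c * δ * V ≤ c * δ * ((K + 1) * (b - a)) := by gcongr
        _ = c * (b - a) / 2 := by rw [hδ]; field_simp
    have h6 := mul_le_mul_of_nonneg_left hbad hL.le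
    have h7 : 0 < c * (b - a) := mul_pos hc hJ0
    linarith

end ExpandingIterates

/-! ### Consequences of cells and spreading: ergodicity, tail sets, support. -/

section CellFamilies

open scoped ENNReal
variable {L : ℝ} {F : Icc (0 : ℝ) L → Icc (0 : ℝ) L}

/-- `G` is a finite set of intervals such that the forward images of any set of positive
measure fill one of them up to a set of arbitrarily small measure. -/
structure IsCellFamily (F : Icc (0 : ℝ) L → Icc (0 : ℝ) L) (G : Finset (ℝ × ℝ)) : Prop where
  le : ∀ p ∈ G, 0 ≤ p.1 ∧ p.1 < p.2 ∧ p.2 ≤ L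
  exists_cell : ∀ (A : Set (Icc (0 : ℝ) L)) (B : ℕ → Set (Icc (0 : ℝ) L)), MeasurableSet A →
    (∀ n, MeasurableSet (B n)) → lebIcc L A ≠ 0 → (∀ n, A ≤ᵐ[lebIcc L] F^[n] ⁻¹' B n) →
    ∃ p ∈ G, ∀ c > 0, ∃ n, (lebIcc L).real (subIoo L p.1 p.2 \ B n) < c

/-- The cells being finite in number, one of them works for all `c`: otherwise the smallest failing
threshold contradicts `exists_cells`. -/
theorem PiecewiseExpanding.exists_isCellFamily {D : Finset ℝ} {Λ : ℝ}
    (hP : PiecewiseExpanding F D Λ) (hF : Measurable F) (hΛ : 1 < Λ) (hL : 0 < L) :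
    ∃ G, IsCellFamily F G := by
  obtain ⟨G, hG, hcell⟩ := hP.exists_cells hF hΛ hL
  refine ⟨G, hG, fun A B hA hB hA0 hAB => ?_⟩
  by_contra! h
  choose! c hc hcn using h
  obtain ⟨-, p₀, hp₀, -⟩ := hcell A B hA hB hA0 hAB 1 one_pos
  obtain ⟨p₁, hp₁, hmin⟩ := Finset.exists_min_image G c ⟨p₀, hp₀⟩
  obtain ⟨n, p, hp, hlt⟩ := hcell A B hA hB hA0 hAB (c p₁) (hc p₁ hp₁)
  exact absurd (hlt.trans_le (hmin p hp)) (not_lt.2 (hcn p hp n))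

theorem lebIcc_subIoo_ne_zero {a b : ℝ} (ha : 0 ≤ a) (hab : a < b) (hb : b ≤ L) :
    lebIcc L (subIoo L a b) ≠ 0 := by
  rw [lebIcc_subIoo ha hb]
  simpa using hab

/-- `F^[n]` spreads the Lebesgue measure on `G` over all of `H`. -/
def Reach (F : Icc (0 : ℝ) L → Icc (0 : ℝ) L) (n : ℕ) (G H : Set (Icc (0 : ℝ) L)) : Prop :=
  ∃ K : ℝ≥0∞, K ≠ ∞ ∧ (lebIcc L).restrict H ≤ K • ((lebIcc L).restrict G).map F^[n]

theorem Reach.lebIcc_inter_le {n : ℕ} {G H : Set (Icc (0 : ℝ) L)} (hF : Measurable F)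
    (h : Reach F n G H) : ∃ K : ℝ≥0∞, K ≠ ∞ ∧ ∀ A, MeasurableSet A →
      lebIcc L (A ∩ H) ≤ K * lebIcc L (F^[n] ⁻¹' A ∩ G) := by
  obtain ⟨K, hK, hle⟩ := h
  refine ⟨K, hK, fun A hA => ?_⟩
  have := hle A
  rwa [Measure.restrict_apply hA, Measure.smul_apply, Measure.map_apply (hF.iterate n) hA,
    Measure.restrict_apply (hF.iterate n hA), smul_eq_mul] at this

/-- If any two intervals spread over a common set, then Lebesgue measure is ergodic. -/
theorem IsCellFamily.lebIcc_eq_zero_or {G : Finset (ℝ × ℝ)} (hG : IsCellFamily F G)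
    (hF : Measurable F)
    (hmeet : ∀ a b a' b', 0 ≤ a → a < b → b ≤ L → 0 ≤ a' → a' < b' → b' ≤ L →
      ∃ n n' H, lebIcc L H ≠ 0 ∧ Reach F n (subIoo L a b) H ∧ Reach F n' (subIoo L a' b') H)
    (A : Set (Icc (0 : ℝ) L)) (hA : MeasurableSet A) (hFA : F ⁻¹' A = A) :
    lebIcc L A = 0 ∨ lebIcc L Aᶜ = 0 := by
  have hinv : ∀ (S : Set (Icc (0 : ℝ) L)), F ⁻¹' S = S → ∀ n, F^[n] ⁻¹' S = S := fun S hS n => by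
    induction n with
    | zero => rfl
    | succ n ih => rw [Function.iterate_succ, preimage_comp, ih, hS]
  have hFA' : F ⁻¹' Aᶜ = Aᶜ := by rw [preimage_compl, hFA]
  -- A nonnull invariant set is its own forward image, so it fills a cell completely. The cells of
  -- `A` and `Aᶜ` would then both spread over `H`, leaving it null.
  have hcell : ∀ S, MeasurableSet S → F ⁻¹' S = S → lebIcc L S ≠ 0 →
      ∃ p ∈ G, lebIcc L (Sᶜ ∩ subIoo L p.1 p.2) = 0 := fun S hS hFS hS0 => by
    obtain ⟨p, hp, h⟩ := hG.exists_cell S (fun _ => S) hS (fun _ => hS) hS0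
      (fun n => by rw [hinv S hFS n]; exact EventuallyLE.rfl)
    refine ⟨p, hp, ?_⟩
    rw [inter_comm, ← Set.sdiff_eq, ← measureReal_eq_zero_iff]
    refine le_antisymm (le_of_forall_pos_lt_add fun c hc => ?_) measureReal_nonneg
    obtain ⟨-, hn⟩ := h c hc
    linarith
  by_contra! h
  obtain ⟨p, hp, hpA⟩ := hcell A hA hFA h.1
  obtain ⟨p', hp', hpA'⟩ := hcell Aᶜ hA.compl hFA' h.2
  rw [compl_compl] at hpA'
  obtain ⟨h1, h2, h3⟩ := hG.le p hp
  obtain ⟨h1', h2', h3'⟩ := hG.le p' hp'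
  obtain ⟨n, n', H, hH, hr, hr'⟩ := hmeet _ _ _ _ h1 h2 h3 h1' h2' h3'
  obtain ⟨K, -, hK⟩ := hr.lebIcc_inter_le hF
  obtain ⟨K', -, hK'⟩ := hr'.lebIcc_inter_le hF
  have e1 := hK Aᶜ hA.compl
  have e2 := hK' A hA
  rw [hinv _ hFA', hpA, mul_zero] at e1
  rw [hinv _ hFA, hpA', mul_zero] at e2
  refine hH (le_antisymm ?_ zero_le)
  rw [← measure_inter_add_sdiff H hA, inter_comm, Set.sdiff_eq, inter_comm H]
  exact (add_le_add e2 e1).trans_eq (add_zero _)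

/-- A set on which an absolutely continuous measure is equivalent to the reference measure. -/
theorem exists_carrier {X : Type*} [MeasurableSpace X] {m μ : Measure X} [IsFiniteMeasure m]
    [IsFiniteMeasure μ] (h : μ ≪ m) : ∃ S, MeasurableSet S ∧ μ Sᶜ = 0 ∧
      ∀ E, μ E = 0 → m (E ∩ S) = 0 := by
  have hm := Measure.measurable_rnDeriv μ m
  have hS : MeasurableSet {x | μ.rnDeriv m x ≠ 0} := (hm (measurableSet_singleton 0)).compl
  have key : ∀ E, μ E = 0 ↔ m ({x | μ.rnDeriv m x ≠ 0} ∩ E) = 0 := fun E => by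
    conv_lhs => rw [← Measure.withDensity_rnDeriv_eq μ m h]
    exact withDensity_apply_eq_zero hm
  refine ⟨_, hS, ?_, fun E hE => ?_⟩
  · rw [key, inter_compl_self, measure_empty]
  · rw [inter_comm]; exact (key E).1 hE

section Invariant

variable {G : Finset (ℝ × ℝ)} {μ : Measure (Icc (0 : ℝ) L)} [IsProbabilityMeasure μ]

/-- For a tail set `A = F^[n] ⁻¹' B n`, invariance gives `μ (B n) = μ A`, while `B n` almost fills a
cell for suitable `n`. So `μ A` is at least the smallest positive measure of a cell. -/
theorem IsCellFamily.exists_tail_bound (hG : IsCellFamily F G) (hF : MeasurePreserving F μ μ)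
    {C : ℝ≥0∞} (hC : C ≠ ∞) (hμ : μ ≤ C • lebIcc L) :
    ∃ δ : ℝ≥0∞, δ ≠ 0 ∧ ∀ A : Set (Icc (0 : ℝ) L),
      (∀ n : ℕ, ∃ B, MeasurableSet B ∧ F^[n] ⁻¹' B = A) → μ A ≠ 0 → δ ≤ μ A := by
  classical
  have hac : μ ≪ lebIcc L := (Measure.absolutelyContinuous_of_le hμ).trans
    (Measure.AbsolutelyContinuous.smul_left Measure.AbsolutelyContinuous.rfl C)
  obtain ⟨S, hS, hS0, hSE⟩ := exists_carrier hac
  let G' := G.filter fun p => μ (subIoo L p.1 p.2) ≠ 0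
  refine ⟨G'.inf fun p => μ (subIoo L p.1 p.2), ?_, fun A hA hA0 => ?_⟩
  · refine (pos_iff_ne_zero.1 ((Finset.lt_inf_iff ENNReal.zero_lt_top).2 fun p hp => ?_))
    exact pos_iff_ne_zero.2 (Finset.mem_filter.1 hp).2
  choose B hB hBA using hA
  have hAm : MeasurableSet A := hBA 0 ▸ hB 0
  have hAS : lebIcc L (A ∩ S) ≠ 0 := fun h => hA0 (by
    rw [← measure_inter_add_sdiff A hS, hac h, zero_add]
    exact measure_mono_null (fun x hx => hx.2) hS0)
  -- Intersecting with the carrier makes the cell lie in `S` up to a null set, so that `μ` charges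
  -- it.
  obtain ⟨p, hp, hcell⟩ := hG.exists_cell (A ∩ S) (fun n => B n ∩ S) (hAm.inter hS)
    (fun n => (hB n).inter hS) hAS (fun n => by
      have h1 : μ (F^[n] ⁻¹' Sᶜ) = 0 :=
        (hF.iterate n).quasiMeasurePreserving.preimage_null hS0
      filter_upwards [measure_eq_zero_iff_ae_notMem.1 (hSE _ h1)] with x hx hxA
      refine ⟨?_, ?_⟩
      · have := hxA.1
        rw [← hBA n] at this
        exact this
      · by_contra h
        exact hx ⟨h, hxA.2⟩)
  obtain ⟨h1, h2, h3⟩ := hG.le p hp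
  have hpS : lebIcc L (subIoo L p.1 p.2 \ S) = 0 := by
    rw [← measureReal_eq_zero_iff]
    refine le_antisymm (le_of_forall_pos_lt_add fun c hc => ?_) measureReal_nonneg
    obtain ⟨n, hn⟩ := hcell c hc
    refine lt_of_le_of_lt (measureReal_mono ?_ (measure_ne_top _ _)) (hn.trans_eq (zero_add c).symm)
    exact fun x hx => ⟨hx.1, fun h => hx.2 h.2⟩
  have hpμ : μ (subIoo L p.1 p.2) ≠ 0 := fun h => lebIcc_subIoo_ne_zero h1 h2 h3 (by
    rw [← measure_inter_add_sdiff (subIoo L p.1 p.2) hS, hSE _ h, hpS, add_zero])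
  refine (Finset.inf_le (Finset.mem_filter.2 ⟨hp, hpμ⟩)).trans ?_
  refine ENNReal.le_of_forall_pos_le_add fun ε hε _ => ?_
  have hε' : (0 : ℝ) < ε / (C.toReal + 1) := by positivity
  obtain ⟨n, hn⟩ := hcell _ hε'
  have hAn : μ (B n) = μ A := by
    rw [← hBA n, (hF.iterate n).measure_preimage (hB n).nullMeasurableSet]
  calc μ (subIoo L p.1 p.2) ≤ μ (B n) + μ (subIoo L p.1 p.2 \ (B n ∩ S)) := by
        rw [← measure_inter_add_sdiff (subIoo L p.1 p.2) ((hB n).inter hS)]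
        gcongr
        exact fun x hx => hx.2.1
    _ ≤ μ A + ε := by
        rw [hAn]
        gcongr
        refine (hμ _).trans ?_
        rw [Measure.smul_apply, smul_eq_mul, ← ENNReal.toReal_le_toReal
          (ENNReal.mul_ne_top hC (measure_ne_top _ _)) ENNReal.coe_ne_top, ENNReal.toReal_mul]
        change C.toReal * (lebIcc L).real _ ≤ ε
        have : C.toReal * (lebIcc L).real (subIoo L p.1 p.2 \ (B n ∩ S)) ≤
            C.toReal * (ε / (C.toReal + 1)) := by gcongr
        refine this.trans ?_
        rw [mul_div_assoc', div_le_iff₀ (by positivity)]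
        nlinarith [ε.coe_nonneg]

/-- Once `B n` fills a cell up to a small set, `k` further steps spread the cell over everything, so
`B (n + k)` has small complement. By invariance this complement has the measure of `Aᶜ`. The number
`k` depends only on the cell, not on the precision. -/
theorem IsCellFamily.tail_trivial (hG : IsCellFamily F G) (hF : MeasurePreserving F μ μ)
    {C : ℝ≥0∞} (hC : C ≠ ∞) (hμ : μ ≤ C • lebIcc L)
    (hreach : ∀ a b, 0 ≤ a → a < b → b ≤ L → ∃ n, Reach F n (subIoo L a b) univ)
    (A : Set (Icc (0 : ℝ) L)) (hA : MeasurableSet A)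
    (htail : ∀ n : ℕ, ∃ B, MeasurableSet B ∧ A =ᵐ[μ] F^[n] ⁻¹' B) : μ A = 0 ∨ μ Aᶜ = 0 := by
  have hac : μ ≪ lebIcc L := (Measure.absolutelyContinuous_of_le hμ).trans
    (Measure.AbsolutelyContinuous.smul_left Measure.AbsolutelyContinuous.rfl C)
  obtain ⟨S, hS, hS0, hSE⟩ := exists_carrier hac
  rw [or_iff_not_imp_left]
  intro hA0
  choose B hB hBA using htail
  have hAS : lebIcc L (A ∩ S) ≠ 0 := fun h => hA0 (by
    rw [← measure_inter_add_sdiff A hS, hac h, zero_add]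
    exact measure_mono_null (fun x hx => hx.2) hS0)
  obtain ⟨p, hp, hcell⟩ := hG.exists_cell (A ∩ S) (fun n => B n ∩ S) (hA.inter hS)
    (fun n => (hB n).inter hS) hAS (fun n => by
      have h1 : μ (F^[n] ⁻¹' Sᶜ) = 0 :=
        (hF.iterate n).quasiMeasurePreserving.preimage_null hS0
      have h2 : μ (A \ F^[n] ⁻¹' B n) = 0 := ae_le_set.1 (hBA n).le
      filter_upwards [measure_eq_zero_iff_ae_notMem.1 (hSE _ h1),
        measure_eq_zero_iff_ae_notMem.1 (hSE _ h2)] with x hx hx' hxA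
      refine ⟨?_, ?_⟩
      · by_contra h
        exact hx' ⟨⟨hxA.1, h⟩, hxA.2⟩
      · by_contra h
        exact hx ⟨h, hxA.2⟩)
  obtain ⟨h1, h2, h3⟩ := hG.le p hp
  obtain ⟨k, hk⟩ := hreach _ _ h1 h2 h3
  obtain ⟨K, hK, hKle⟩ := hk.lebIcc_inter_le hF.measurable
  refine le_antisymm (ENNReal.le_of_forall_pos_le_add fun ε hε _ => ?_) zero_le
  have hε' : (0 : ℝ) < ε / ((C * K).toReal + 1) := by positivity
  obtain ⟨n, hn⟩ := hcell _ hε'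
  have hAc : μ Aᶜ = μ (B (n + k))ᶜ := by
    rw [← (hF.iterate (n + k)).measure_preimage (hB _).compl.nullMeasurableSet]
    exact measure_congr (hBA (n + k)).compl
  have hrel : μ (B n \ F^[k] ⁻¹' B (n + k)) = 0 := by
    rw [← (hF.iterate n).measure_preimage
      ((hB n).diff (hF.measurable.iterate k (hB _))).nullMeasurableSet, preimage_sdiff,
      ← preimage_comp, ← Function.iterate_add, add_comm k n]
    exact ae_le_set.1 ((hBA n).symm.trans (hBA (n + k))).le
  have hle : lebIcc L (F^[k] ⁻¹' (B (n + k))ᶜ ∩ subIoo L p.1 p.2) ≤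
      lebIcc L (subIoo L p.1 p.2 \ (B n ∩ S)) := by
    refine measure_mono_ae ?_
    filter_upwards [measure_eq_zero_iff_ae_notMem.1 (hSE _ hrel)] with x hx hxB
    refine ⟨hxB.2, fun h => hx ⟨⟨h.1, hxB.1⟩, h.2⟩⟩
  have hB' := hKle _ (hB (n + k)).compl
  rw [inter_univ] at hB'
  calc μ Aᶜ ≤ C * lebIcc L (B (n + k))ᶜ := by rw [hAc]; exact hμ _
    _ ≤ C * (K * lebIcc L (subIoo L p.1 p.2 \ (B n ∩ S))) := by gcongr; exact hB'.trans (by gcongr)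
    _ ≤ 0 + ε := by
        rw [zero_add, ← mul_assoc, ← ENNReal.toReal_le_toReal
          (ENNReal.mul_ne_top (ENNReal.mul_ne_top hC hK) (measure_ne_top _ _)) ENNReal.coe_ne_top,
          ENNReal.toReal_mul]
        change (C * K).toReal * (lebIcc L).real _ ≤ ε
        have : (C * K).toReal * (lebIcc L).real (subIoo L p.1 p.2 \ (B n ∩ S)) ≤
            (C * K).toReal * (ε / ((C * K).toReal + 1)) := by gcongr
        refine this.trans ?_
        rw [mul_div_assoc', div_le_iff₀ (by positivity)]
        nlinarith [ε.coe_nonneg]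

/-- The carrier of `μ` is forward invariant modulo null sets, so it contains a cell. Null sets of
`μ` pull back to null sets of that cell, which spreads over all of `[0, L]`. -/
theorem IsCellFamily.lebIcc_absolutelyContinuous (hG : IsCellFamily F G)
    (hF : MeasurePreserving F μ μ) (hac : μ ≪ lebIcc L)
    (hreach : ∀ a b, 0 ≤ a → a < b → b ≤ L → ∃ n, Reach F n (subIoo L a b) univ) :
    lebIcc L ≪ μ := by
  obtain ⟨S, hS, hS0, hSE⟩ := exists_carrier hac
  have hSL : lebIcc L S ≠ 0 := fun h => by
    have h1 := prob_add_prob_compl (μ := μ) hS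
    rw [hS0, hac h, add_zero] at h1
    exact zero_ne_one h1
  obtain ⟨p, hp, hcell⟩ := hG.exists_cell S (fun _ => S) hS (fun _ => hS) hSL (fun n => by
      have h1 : μ (F^[n] ⁻¹' Sᶜ) = 0 :=
        (hF.iterate n).quasiMeasurePreserving.preimage_null hS0
      filter_upwards [measure_eq_zero_iff_ae_notMem.1 (hSE _ h1)] with x hx hxS
      by_contra h
      exact hx ⟨h, hxS⟩)
  have hpS : lebIcc L (subIoo L p.1 p.2 \ S) = 0 := by
    rw [← measureReal_eq_zero_iff]
    refine le_antisymm (le_of_forall_pos_lt_add fun c hc => ?_) measureReal_nonneg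
    obtain ⟨n, hn⟩ := hcell c hc
    linarith
  obtain ⟨h1, h2, h3⟩ := hG.le p hp
  obtain ⟨k, hk⟩ := hreach _ _ h1 h2 h3
  obtain ⟨K, -, hKle⟩ := hk.lebIcc_inter_le hF.measurable
  refine Measure.AbsolutelyContinuous.mk fun E hE hE0 => ?_
  have h4 := hKle E hE
  rw [inter_univ] at h4
  refine le_antisymm (h4.trans ?_) zero_le
  have h5 : lebIcc L (F^[k] ⁻¹' E ∩ S) = 0 :=
    hSE _ ((hF.iterate k).quasiMeasurePreserving.preimage_null hE0)
  have h6 : lebIcc L (F^[k] ⁻¹' E ∩ subIoo L p.1 p.2) = 0 :=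
    measure_mono_null (fun x hx => by
      by_cases hxS : x ∈ S
      · exact Or.inl ⟨hx.1, hxS⟩
      · exact Or.inr ⟨hx.2, hxS⟩) (measure_union_null h5 hpS)
  rw [h6, mul_zero]

end Invariant

theorem support_eq_univ_of_lebIcc_absolutelyContinuous {μ : Measure (Icc (0 : ℝ) L)} (hL : 0 < L)
    (h : lebIcc L ≪ μ) : μ.support = univ := by
  refine eq_univ_of_forall fun x => (Measure.mem_support_iff_forall x).2 fun U hU => ?_
  rw [pos_iff_ne_zero]
  intro hU0
  obtain ⟨ε, hε, hball⟩ := Metric.mem_nhds_iff.1 hU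
  have hx := x.2
  refine lebIcc_subIoo_ne_zero (L := L) (a := max 0 (x - ε)) (b := min L (x + ε))
    (le_max_left _ _) ?_ (min_le_left _ _) (measure_mono_null ?_ (h hU0))
  · rw [lt_min_iff, max_lt_iff, max_lt_iff]
    exact ⟨⟨hL, by linarith [hx.2]⟩, by linarith [hx.1], by linarith⟩
  · rintro y ⟨hy1, hy2⟩
    refine hball ?_
    rw [Metric.mem_ball, Subtype.dist_eq, Real.dist_eq, abs_lt]
    have h1 := (le_max_right (0 : ℝ) (x - ε)).trans_lt hy1
    have h2 := hy2.trans_le (min_le_right L (x + ε))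
    constructor <;> linarith

end CellFamilies

/-! ### Dynamics of the slap map in its piecewise affine normal form. -/

section TriangleSlap

open scoped ENNReal

section Reach
variable {L : ℝ} {F : Icc (0 : ℝ) L → Icc (0 : ℝ) L} {G G' H H' I : Set (Icc (0 : ℝ) L)} {n k : ℕ}

theorem Reach.refl (F : Icc (0 : ℝ) L → Icc (0 : ℝ) L) (G : Set (Icc (0 : ℝ) L)) :
    Reach F 0 G G := ⟨1, by simp, by simp⟩

theorem Reach.trans (hF : Measurable F) (h : Reach F n G H) (h' : Reach F k H I) :
    Reach F (n + k) G I := by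
  obtain ⟨K, hK, hle⟩ := h
  obtain ⟨K', hK', hle'⟩ := h'
  refine ⟨K' * K, ENNReal.mul_ne_top hK' hK, hle'.trans ?_⟩
  have h1 := Measure.map_mono hle (hF.iterate k)
  rw [Measure.map_smul, Measure.map_map (hF.iterate k) (hF.iterate n), ← Function.iterate_add,
    add_comm k n] at h1
  rw [mul_smul]
  exact Measure.le_iff.2 fun A _ => by
    rw [Measure.smul_apply, Measure.smul_apply, smul_eq_mul, smul_eq_mul]
    exact mul_le_mul' le_rfl (h1 A)

theorem Reach.mono (hF : Measurable F) (h : Reach F n G H) (hG : G ⊆ G') (hH : H' ⊆ H) :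
    Reach F n G' H' := by
  obtain ⟨K, hK, hle⟩ := h
  refine ⟨K, hK, (Measure.restrict_mono hH le_rfl).trans (hle.trans ?_)⟩
  have h1 := Measure.map_mono (Measure.restrict_mono hG (le_refl (lebIcc L))) (hF.iterate n)
  exact Measure.le_iff.2 fun A _ => by
    rw [Measure.smul_apply, Measure.smul_apply, smul_eq_mul, smul_eq_mul]
    exact mul_le_mul' le_rfl (h1 A)

theorem AffineOnIoo.reach {a b s t : ℝ} (h : AffineOnIoo F a b s t) (hF : Measurable F)
    (ha : 0 ≤ a) (hab : a < b) (hb : b ≤ L) (hs : s ≠ 0) : Reach F 1 (subIoo L a b)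
      (subIoo L (min (s * a + t) (s * b + t)) (max (s * a + t) (s * b + t))) := by
  refine ⟨ENNReal.ofReal |s|, ENNReal.ofReal_ne_top, ?_⟩
  rw [Function.iterate_one, h.map_restrict hF ha hab hb hs, smul_smul,
    ← ENNReal.ofReal_mul (abs_nonneg s), mul_inv_cancel₀ (abs_ne_zero.2 hs), ENNReal.ofReal_one,
    one_smul]

end Reach

/-- The interval `[0, L]` is decomposed into three sides of lengths `ℓ i`, starting at `σ i`. -/
structure IsSideDecomposition (ℓ σ : Fin 3 → ℝ) (L : ℝ) : Prop where
  pos : ∀ i, 0 < ℓ i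
  start_zero : σ 0 = 0
  start_one : σ 1 = ℓ 0
  start_two : σ 2 = ℓ 0 + ℓ 1
  length_eq : L = ℓ 0 + ℓ 1 + ℓ 2

namespace IsSideDecomposition

variable {ℓ σ : Fin 3 → ℝ} {L : ℝ}

theorem length_pos (h : IsSideDecomposition ℓ σ L) : 0 < L := by
  rw [h.length_eq]; linarith [h.pos 0, h.pos 1, h.pos 2]

theorem start_nonneg (h : IsSideDecomposition ℓ σ L) (i : Fin 3) : 0 ≤ σ i := by
  have := h.pos 0; have := h.pos 1
  fin_cases i <;> simp [h.start_zero, h.start_one, h.start_two] <;> linarith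

theorem end_le (h : IsSideDecomposition ℓ σ L) (i : Fin 3) : σ i + ℓ i ≤ L := by
  have := h.pos 1; have := h.pos 2
  rw [h.length_eq]
  fin_cases i <;> simp [h.start_zero, h.start_one, h.start_two] <;> linarith

theorem exists_side (h : IsSideDecomposition ℓ σ L) {a b : ℝ} (ha : 0 ≤ a) (hab : a < b)
    (hb : b ≤ L) : ∃ i, max a (σ i) < min b (σ i + ℓ i) := by
  have h0 := h.start_zero
  have h1 := h.start_one
  have h2 := h.start_two
  have hL := h.length_eq
  have := h.pos 0; have := h.pos 1; have := h.pos 2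
  rcases lt_or_ge a (ℓ 0) with h3 | h3
  · exact ⟨0, by rw [max_lt_iff, lt_min_iff, lt_min_iff]; refine ⟨⟨?_, ?_⟩, ?_, ?_⟩ <;> linarith⟩
  rcases lt_or_ge a (ℓ 0 + ℓ 1) with h4 | h4
  · exact ⟨1, by rw [max_lt_iff, lt_min_iff, lt_min_iff]; refine ⟨⟨?_, ?_⟩, ?_, ?_⟩ <;> linarith⟩
  · exact ⟨2, by rw [max_lt_iff, lt_min_iff, lt_min_iff]; refine ⟨⟨?_, ?_⟩, ?_, ?_⟩ <;> linarith⟩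

theorem side_unique (h : IsSideDecomposition ℓ σ L) {i j : Fin 3} {x : ℝ}
    (hi : x ∈ Ioo (σ i) (σ i + ℓ i)) (hj : x ∈ Ioo (σ j) (σ j + ℓ j)) : i = j := by
  have h0 := h.start_zero
  have h1 := h.start_one
  have h2 := h.start_two
  have := h.pos 0; have := h.pos 1; have := h.pos 2
  obtain ⟨a1, a2⟩ := hi
  obtain ⟨b1, b2⟩ := hj
  fin_cases i <;> fin_cases j <;> simp only [Fin.zero_eta, Fin.mk_one, Fin.reduceFinMk] at * <;>
    first | rfl | (exfalso; linarith)

/-- All but finitely many points are in the interior of a side, and different from a given point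
of that side. -/
theorem finite_compl_sides (h : IsSideDecomposition ℓ σ L) (φ : Fin 3 → ℝ) :
    {x : Icc (0 : ℝ) L |
      ¬ ∃ i, (x : ℝ) ∈ Ioo (σ i) (σ i + ℓ i) ∧ (x : ℝ) - σ i ≠ φ i}.Finite := by
  have hfin : ({0, ℓ 0, ℓ 0 + ℓ 1, L} ∪ range fun i => σ i + φ i : Set ℝ).Finite :=
    (Set.toFinite _).union (Set.finite_range _)
  refine (hfin.preimage Subtype.val_injective.injOn).subset fun x hx => ?_
  by_contra hn
  simp only [mem_preimage, mem_union, mem_insert_iff, mem_singleton_iff, mem_range, not_or,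
    not_exists] at hn
  obtain ⟨⟨hx0, hx1, hx2, hxL⟩, hφ⟩ := hn
  refine hx ?_
  have hφ' : ∀ i, (x : ℝ) - σ i ≠ φ i := fun i hi => hφ i (by linarith)
  have h0 := h.start_zero
  have h1 := h.start_one
  have h2 := h.start_two
  have hL := h.length_eq
  have hx0' := lt_of_le_of_ne x.2.1 (Ne.symm hx0)
  have hxL' := lt_of_le_of_ne x.2.2 hxL
  rcases lt_or_gt_of_ne hx1 with h3 | h3
  · exact ⟨0, ⟨by linarith, by linarith⟩, hφ' 0⟩
  rcases lt_or_gt_of_ne hx2 with h4 | h4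
  · exact ⟨1, ⟨by linarith, by linarith⟩, hφ' 1⟩
  · exact ⟨2, ⟨by linarith, by linarith⟩, hφ' 2⟩

end IsSideDecomposition

/-- `F` is the slap map of a triangle with side lengths `ℓ`, cosines of the angles `c` and arc
length parameters `σ` of the vertices. The foot of the altitude on the side `i` is at distance
`ℓ (i + 2) * c i` from the vertex `i`. -/
structure IsTriangleSlap (ℓ c σ : Fin 3 → ℝ) (L : ℝ) (F : Icc (0 : ℝ) L → Icc (0 : ℝ) L) : Prop
    extends IsSideDecomposition ℓ σ L where
  measurable : Measurable F
  abs_lt : ∀ i, |c i| < 1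
  proj : ∀ i, ℓ i = ℓ (i + 2) * c i + ℓ (i + 1) * c (i + 1)
  left : ∀ i (x : Icc (0 : ℝ) L), σ i < x → x < σ i + ℓ i → x - σ i < ℓ (i + 2) * c i →
    (F x : ℝ) = σ (i + 2) + ℓ (i + 2) - (x - σ i) / c i
  right : ∀ i (x : Icc (0 : ℝ) L), σ i < x → x < σ i + ℓ i → ℓ (i + 2) * c i < x - σ i →
    (F x : ℝ) = σ (i + 1) + (σ i + ℓ i - x) / c (i + 1)

namespace IsTriangleSlap

variable {ℓ c σ : Fin 3 → ℝ} {L : ℝ} {F : Icc (0 : ℝ) L → Icc (0 : ℝ) L}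

theorem exists_slope (h : IsTriangleSlap ℓ c σ L F) : ∃ Λ > 1, ∀ i, Λ * |c i| ≤ 1 := by
  -- The entry `1 / 2` only keeps `κ` visibly positive.
  set κ := max (1 / 2) (max |c 0| (max |c 1| |c 2|)) with hκ
  have hκ0 : 0 < κ := lt_of_lt_of_le one_half_pos (le_max_left _ _)
  have hκ1 : κ < 1 := max_lt one_half_lt_one
    (max_lt (h.abs_lt 0) (max_lt (h.abs_lt 1) (h.abs_lt 2)))
  refine ⟨κ⁻¹, (one_lt_inv₀ hκ0).2 hκ1, fun i => ?_⟩
  rw [inv_mul_le_iff₀ hκ0, mul_one]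
  fin_cases i <;> simp [hκ]

/-- A nonempty branch forces its angle to be acute, so divisions by the cosine are legitimate
wherever the branch is used. -/
theorem cos_pos_of_left (h : IsTriangleSlap ℓ c σ L F) {i : Fin 3} {t : ℝ} (ht : 0 < t)
    (hlt : t ≤ ℓ (i + 2) * c i) : 0 < c i :=
  pos_of_mul_pos_right (ht.trans_le hlt) (h.pos _).le

theorem cos_pos_of_right (h : IsTriangleSlap ℓ c σ L F) {i : Fin 3} {t : ℝ} (ht : t < ℓ i)
    (hlt : ℓ (i + 2) * c i ≤ t) : 0 < c (i + 1) := by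
  have := h.proj i
  exact pos_of_mul_pos_right (b := c (i + 1)) (show 0 < ℓ (i + 1) * c (i + 1) by linarith)
    (h.pos _).le

theorem affineOnIoo_left (h : IsTriangleSlap ℓ c σ L F) {i : Fin 3} {a b : ℝ} (ha : 0 ≤ a)
    (hb : b ≤ ℓ i) (hφ : b ≤ ℓ (i + 2) * c i) :
    AffineOnIoo F (σ i + a) (σ i + b) (-(c i)⁻¹) (σ (i + 2) + ℓ (i + 2) + σ i / c i) := by
  intro x hx1 hx2
  rw [h.left i x (by linarith) (by linarith) (by linarith)]
  ring

theorem affineOnIoo_right (h : IsTriangleSlap ℓ c σ L F) {i : Fin 3} {a b : ℝ} (ha : 0 ≤ a)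
    (hb : b ≤ ℓ i) (hφ : ℓ (i + 2) * c i ≤ a) :
    AffineOnIoo F (σ i + a) (σ i + b) (-(c (i + 1))⁻¹)
      (σ (i + 1) + (σ i + ℓ i) / c (i + 1)) := by
  intro x hx1 hx2
  rw [h.right i x (by linarith) (by linarith) (by linarith)]
  ring

open Classical in
theorem piecewiseExpanding (h : IsTriangleSlap ℓ c σ L F) {Λ : ℝ}
    (hΛc : ∀ i, Λ * |c i| ≤ 1) :
    PiecewiseExpanding F (Finset.univ.biUnion fun i =>
      {σ i, σ i + ℓ i, σ i + ℓ (i + 2) * c i}) Λ := by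
  intro a b ha hab hb hD
  have hD' : ∀ i, (σ i ∉ Ioo a b) ∧ (σ i + ℓ i ∉ Ioo a b) ∧ (σ i + ℓ (i + 2) * c i ∉ Ioo a b) :=
    fun i =>
      have hmem : ∀ d ∈ ({σ i, σ i + ℓ i, σ i + ℓ (i + 2) * c i} : Finset ℝ), d ∉ Ioo a b :=
        fun d hd => hD d (Finset.mem_biUnion.2 ⟨i, Finset.mem_univ i, hd⟩)
      ⟨hmem _ (by simp), hmem _ (by simp), hmem _ (by simp)⟩
  obtain ⟨i, hi⟩ := h.exists_side ha hab hb
  rw [max_lt_iff, lt_min_iff, lt_min_iff] at hi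
  obtain ⟨⟨-, hi1⟩, hi2, -⟩ := hi
  obtain ⟨d1, d2, d3⟩ := hD' i
  have e1 : σ i ≤ a := by by_contra h'; exact d1 ⟨not_le.1 h', hi2⟩
  have e2 : b ≤ σ i + ℓ i := by by_contra h'; exact d2 ⟨hi1, not_le.1 h'⟩
  have habs : ∀ j, 0 < c j → Λ ≤ |-(c j)⁻¹| := fun j hj => by
    have := hΛc j
    rw [abs_of_pos hj] at this
    rw [abs_neg, abs_of_pos (inv_pos.2 hj), ← one_div, le_div_iff₀ hj]
    exact this
  rcases le_or_gt b (σ i + ℓ (i + 2) * c i) with h3 | h3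
  · have hc : 0 < c i := h.cos_pos_of_left (t := b - σ i) (by linarith) (by linarith)
    refine ⟨_, σ (i + 2) + ℓ (i + 2) + σ i / c i, habs i hc, ?_⟩
    have := h.affineOnIoo_left (i := i) (a := a - σ i) (b := b - σ i) (by linarith) (by linarith)
      (by linarith)
    simpa using this
  · have h4 : σ i + ℓ (i + 2) * c i ≤ a := by by_contra h'; exact d3 ⟨not_le.1 h', h3⟩
    have hc : 0 < c (i + 1) := h.cos_pos_of_right (t := a - σ i) (by linarith) (by linarith)
    refine ⟨_, σ (i + 1) + (σ i + ℓ i) / c (i + 1), habs (i + 1) hc, ?_⟩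
    have := h.affineOnIoo_right (i := i) (a := a - σ i) (b := b - σ i) (by linarith) (by linarith)
      (by linarith)
    simpa using this

/-- The part of the side `i` between the distances `a` and `b` from the vertex `i`. -/
def side (σ : Fin 3 → ℝ) (L : ℝ) (i : Fin 3) (a b : ℝ) : Set (Icc (0 : ℝ) L) :=
  subIoo L (σ i + a) (σ i + b)

theorem side_subset {i : Fin 3} {a b a' b' : ℝ} (ha : a' ≤ a) (hb : b ≤ b') :
    side σ L i a b ⊆ side σ L i a' b' := by
  rintro x ⟨h1, h2⟩
  exact ⟨by linarith, by linarith⟩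

theorem reach_left (h : IsTriangleSlap ℓ c σ L F) {i : Fin 3} {a b : ℝ} (ha : 0 ≤ a) (hab : a < b)
    (hb : b ≤ ℓ i) (hφ : b ≤ ℓ (i + 2) * c i) :
    Reach F 1 (side σ L i a b) (side σ L (i + 2) (ℓ (i + 2) - b / c i) (ℓ (i + 2) - a / c i)) := by
  have hc : 0 < c i := h.cos_pos_of_left (ha.trans_lt hab) hφ
  have h1 := (h.affineOnIoo_left ha hb hφ).reach h.measurable
    (by linarith [h.start_nonneg i]) (by linarith) (by linarith [h.end_le i])
    (neg_ne_zero.2 (inv_ne_zero hc.ne'))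
  have e : ∀ u, -(c i)⁻¹ * (σ i + u) + (σ (i + 2) + ℓ (i + 2) + σ i / c i) =
      σ (i + 2) + (ℓ (i + 2) - u / c i) := fun u => by ring
  rw [e, e] at h1
  have hle : a / c i ≤ b / c i := by gcongr
  rwa [min_eq_right (by linarith), max_eq_left (by linarith)] at h1

theorem reach_right (h : IsTriangleSlap ℓ c σ L F) {i : Fin 3} {a b : ℝ} (ha : 0 ≤ a)
    (hab : a < b) (hb : b ≤ ℓ i) (hφ : ℓ (i + 2) * c i ≤ a) :
    Reach F 1 (side σ L i a b)
      (side σ L (i + 1) ((ℓ i - b) / c (i + 1)) ((ℓ i - a) / c (i + 1))) := by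
  have hc : 0 < c (i + 1) := h.cos_pos_of_right (hab.trans_le hb) hφ
  have h1 := (h.affineOnIoo_right ha hb hφ).reach h.measurable
    (by linarith [h.start_nonneg i]) (by linarith) (by linarith [h.end_le i])
    (neg_ne_zero.2 (inv_ne_zero hc.ne'))
  have e : ∀ u, -(c (i + 1))⁻¹ * (σ i + u) + (σ (i + 1) + (σ i + ℓ i) / c (i + 1)) =
      σ (i + 1) + (ℓ i - u) / c (i + 1) := fun u => by ring
  rw [e, e] at h1
  have hle : (ℓ i - b) / c (i + 1) ≤ (ℓ i - a) / c (i + 1) := by gcongr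
  rwa [min_eq_right (by linarith), max_eq_left (by linarith)] at h1

/-- Every interval spreads over an interval of a side containing the foot of the altitude. -/
theorem exists_reach_foot (h : IsTriangleSlap ℓ c σ L F) {a b : ℝ} (ha : 0 ≤ a) (hab : a < b)
    (hb : b ≤ L) : ∃ n j a' b', 0 ≤ a' ∧ a' < ℓ (j + 2) * c j ∧ ℓ (j + 2) * c j < b' ∧ b' ≤ ℓ j ∧
      Reach F n (subIoo L a b) (side σ L j a' b') := by
  obtain ⟨Λ, hΛ, hΛc⟩ := h.exists_slope
  obtain ⟨i, hi⟩ := h.exists_side ha hab hb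
  set u := max a (σ i)
  set v := min b (σ i + ℓ i)
  -- As long as the image does not contain a foot in its interior, it lies in one branch and its
  -- length grows by the factor `Λ`; lengths are bounded by `L`.
  by_contra! hno
  have key : ∀ k : ℕ, ∃ n j a' b', 0 ≤ a' ∧ b' ≤ ℓ j ∧ Λ ^ k * (v - u) ≤ b' - a' ∧
      Reach F n (subIoo L a b) (side σ L j a' b') := fun k => by
    induction k with
    | zero =>
      refine ⟨0, i, u - σ i, v - σ i, sub_nonneg.2 (le_max_right _ _), ?_, by simp, ?_⟩
      · have : v ≤ σ i + ℓ i := min_le_right _ _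
        linarith
      · refine (Reach.refl F _).mono h.measurable Subset.rfl ?_
        rintro x ⟨h1, h2⟩
        rw [add_sub_cancel] at h1 h2
        exact ⟨(le_max_left _ _).trans_lt h1, h2.trans_le (min_le_left _ _)⟩
    | succ k ih =>
      obtain ⟨n, j, a', b', ha', hb', hlen, hreach⟩ := ih
      have hpos : 0 < Λ ^ k * (v - u) := mul_pos (pow_pos (zero_lt_one.trans hΛ) k) (sub_pos.2 hi)
      have hab' : a' < b' := by linarith
      have hexp : ∀ j, 0 < c j → Λ ^ (k + 1) * (v - u) ≤ (b' - a') / c j := fun j hj => by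
        rw [le_div_iff₀ hj]
        have h1 := hΛc j
        rw [abs_of_pos hj] at h1
        calc Λ ^ (k + 1) * (v - u) * c j = (Λ * c j) * (Λ ^ k * (v - u)) := by ring
          _ ≤ 1 * (Λ ^ k * (v - u)) := by gcongr
          _ ≤ b' - a' := by linarith
      rcases le_or_gt b' (ℓ (j + 2) * c j) with h1 | h1
      · have hc : 0 < c j := h.cos_pos_of_left (ha'.trans_lt hab') h1
        refine ⟨n + 1, j + 2, ℓ (j + 2) - b' / c j, ℓ (j + 2) - a' / c j, ?_, ?_, ?_,
          hreach.trans h.measurable (h.reach_left ha' hab' hb' h1)⟩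
        · rw [sub_nonneg, div_le_iff₀ hc]; exact h1
        · rw [sub_le_self_iff]; positivity
        · refine (hexp j hc).trans_eq ?_
          ring
      · have h2 : ℓ (j + 2) * c j ≤ a' := by
          by_contra h'
          exact hno n j a' b' ha' (not_le.1 h') h1 hb' hreach
        have hc : 0 < c (j + 1) := h.cos_pos_of_right (hab'.trans_le hb') h2
        refine ⟨n + 1, j + 1, (ℓ j - b') / c (j + 1), (ℓ j - a') / c (j + 1), ?_, ?_, ?_,
          hreach.trans h.measurable (h.reach_right ha' hab' hb' h2)⟩
        · exact div_nonneg (sub_nonneg.2 hb') hc.le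
        · rw [div_le_iff₀ hc]
          linarith [h.proj j]
        · refine (hexp _ hc).trans_eq ?_
          ring
  have hvu : 0 < v - u := sub_pos.2 hi
  obtain ⟨k, hk⟩ := pow_unbounded_of_one_lt (L / (v - u)) hΛ
  obtain ⟨n, j, a', b', ha', hb', hlen, -⟩ := key k
  rw [div_lt_iff₀ hvu] at hk
  linarith [h.end_le j, h.start_nonneg j]

/-! ### Acute triangles: every interval spreads over the whole boundary. -/

section Acute

theorem reach_side_add_two (h : IsTriangleSlap ℓ c σ L F) (hc : ∀ i, 0 < c i) (i : Fin 3) :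
    Reach F 1 (side σ L i 0 (ℓ (i + 2) * c i)) (side σ L (i + 2) 0 (ℓ (i + 2))) := by
  have hφ : 0 < ℓ (i + 2) * c i := mul_pos (h.pos _) (hc i)
  have := h.reach_left le_rfl hφ (by
    have := h.proj i
    nlinarith [h.pos (i + 1), hc (i + 1)]) le_rfl
  rwa [mul_div_cancel_right₀ _ (hc i).ne', sub_self, zero_div, sub_zero] at this

theorem reach_side_add_one (h : IsTriangleSlap ℓ c σ L F) (hc : ∀ i, 0 < c i) (i : Fin 3) :
    Reach F 1 (side σ L i (ℓ (i + 2) * c i) (ℓ i)) (side σ L (i + 1) 0 (ℓ (i + 1))) := by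
  have hφ : 0 < ℓ (i + 2) * c i := mul_pos (h.pos _) (hc i)
  have hproj := h.proj i
  have := h.reach_right hφ.le (by nlinarith [h.pos (i + 1), hc (i + 1)]) le_rfl le_rfl
  rwa [sub_self, zero_div, show ℓ i - ℓ (i + 2) * c i = ℓ (i + 1) * c (i + 1) by linarith,
    mul_div_cancel_right₀ _ (hc _).ne'] at this

theorem foot_lt (h : IsTriangleSlap ℓ c σ L F) (hc : ∀ i, 0 < c i) (i : Fin 3) :
    ℓ (i + 2) * c i < ℓ i := by
  have := h.proj i
  nlinarith [h.pos (i + 1), hc (i + 1)]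

/-- An interval starting at the vertex `i` is reflected back and forth between the two sides there,
growing by `1 / c i` each time. When it reaches a foot, it contains a full branch, whose image is a
whole side. -/
theorem exists_reach_side (h : IsTriangleSlap ℓ c σ L F) (hc : ∀ i, 0 < c i) (i : Fin 3) {η : ℝ}
    (hη : 0 < η) : ∃ n j, Reach F n (side σ L i 0 η) (side σ L j 0 (ℓ j)) := by
  obtain ⟨Λ, hΛ, hΛc⟩ := h.exists_slope
  have e3 : i + 2 + 1 = i := by revert i; decide
  have e4 : i + 2 + 2 = i + 1 := by revert i; decide
  by_contra! hno
  have key : ∀ k : ℕ, ∃ n, ∃ η', Λ ^ k * η ≤ η' ∧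
      Reach F n (side σ L i 0 η) (side σ L i 0 η') := fun k => by
    induction k with
    | zero => exact ⟨0, η, by simp, Reach.refl F _⟩
    | succ k ih =>
      obtain ⟨n, η', hle, hreach⟩ := ih
      have hη' : 0 < η' := lt_of_lt_of_le (by positivity) hle
      have hci := hc i
      have hlt : η' < ℓ (i + 2) * c i := by
        by_contra h'
        refine hno (n + 1) (i + 2) (hreach.trans h.measurable ?_)
        exact (h.reach_side_add_two hc i).mono h.measurable
          (side_subset le_rfl (not_lt.1 h')) Subset.rfl
      have h1 := h.reach_left le_rfl hη' (hlt.le.trans (h.foot_lt hc i).le) hlt.le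
      rw [zero_div, sub_zero] at h1
      have hlt2 : ℓ (i + 2 + 2) * c (i + 2) < ℓ (i + 2) - η' / c i := by
        by_contra h'
        refine hno (n + 1 + 1) (i + 2 + 1) ((hreach.trans h.measurable h1).trans h.measurable ?_)
        exact (h.reach_side_add_one hc (i + 2)).mono h.measurable
          (side_subset (not_lt.1 h') le_rfl) Subset.rfl
      have h2 := h.reach_right (i := i + 2) (a := ℓ (i + 2) - η' / c i) (b := ℓ (i + 2))
        (by rw [sub_nonneg, div_le_iff₀ hci]; exact hlt.le)
        (by rw [sub_lt_self_iff]; positivity) le_rfl hlt2.le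
      rw [sub_self, zero_div, sub_sub_cancel, e3] at h2
      refine ⟨n + 1 + 1, η' / c i / c i, ?_, (hreach.trans h.measurable h1).trans h.measurable h2⟩
      have h3 := hΛc i
      rw [abs_of_pos hci] at h3
      have h4 : c i ≤ 1 := (abs_of_pos hci ▸ h.abs_lt i).le
      rw [le_div_iff₀ hci, le_div_iff₀ hci]
      calc Λ ^ (k + 1) * η * c i * c i = (Λ * c i) * c i * (Λ ^ k * η) := by ring
        _ ≤ 1 * 1 * (Λ ^ k * η) := by gcongr
        _ ≤ η' := by linarith
  obtain ⟨k, hk⟩ := pow_unbounded_of_one_lt (ℓ i / η) hΛ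
  obtain ⟨n, η', hle, hreach⟩ := key k
  rw [div_lt_iff₀ hη] at hk
  exact hno n i (hreach.mono h.measurable Subset.rfl (side_subset le_rfl (hk.le.trans hle)))

/-- Each side covers both others in one step, so every side, including the initial one, is covered
in exactly two steps. -/
theorem reach_univ_of_side (h : IsTriangleSlap ℓ c σ L F) (hc : ∀ i, 0 < c i) (i : Fin 3) :
    Reach F 2 (side σ L i 0 (ℓ i)) univ := by
  have h2 : ∀ i, Reach F 1 (side σ L i 0 (ℓ i)) (side σ L (i + 2) 0 (ℓ (i + 2))) := fun i =>
    (h.reach_side_add_two hc i).mono h.measurable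
      (side_subset le_rfl (h.foot_lt hc i).le) Subset.rfl
  have h1 : ∀ i, Reach F 1 (side σ L i 0 (ℓ i)) (side σ L (i + 1) 0 (ℓ (i + 1))) := fun i =>
    (h.reach_side_add_one hc i).mono h.measurable
      (side_subset (mul_pos (h.pos _) (hc i)).le le_rfl) Subset.rfl
  have hall : ∀ j, Reach F 2 (side σ L i 0 (ℓ i)) (side σ L j 0 (ℓ j)) := fun j => by
    have e : j = i + 1 + 2 ∨ j = i + 1 + 1 ∨ j = i + 2 + 2 := by revert i j; decide
    rcases e with rfl | rfl | rfl
    · exact (h1 i).trans h.measurable (h2 _)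
    · exact (h1 i).trans h.measurable (h1 _)
    · exact (h2 i).trans h.measurable (h2 _)
  obtain ⟨K₀, hK₀, hle₀⟩ := hall 0
  obtain ⟨K₁, hK₁, hle₁⟩ := hall 1
  obtain ⟨K₂, hK₂, hle₂⟩ := hall 2
  generalize side σ L i 0 (ℓ i) = S at hle₀ hle₁ hle₂ ⊢
  refine ⟨K₀ + (K₁ + K₂), ENNReal.add_ne_top.2 ⟨hK₀, ENNReal.add_ne_top.2 ⟨hK₁, hK₂⟩⟩, ?_⟩
  have p0 := h.pos 0; have p1 := h.pos 1; have p2 := h.pos 2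
  have hL := h.length_eq
  rw [← Measure.restrict_congr_set (subIoo_univ_ae L),
    lebIcc_restrict_subIoo_split (d := ℓ 0) p0 (by linarith),
    lebIcc_restrict_subIoo_split (a := ℓ 0) (d := ℓ 0 + ℓ 1) (by linarith) (by linarith),
    add_smul, add_smul]
  simp only [side, h.start_zero, h.start_one, h.start_two, add_zero, zero_add] at hle₀ hle₁ hle₂
  rw [← hL] at hle₂
  exact add_le_add hle₀ (add_le_add hle₁ hle₂)

theorem exists_reach_univ (h : IsTriangleSlap ℓ c σ L F) (hc : ∀ i, 0 < c i) {a b : ℝ}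
    (ha : 0 ≤ a) (hab : a < b) (hb : b ≤ L) : ∃ n, Reach F n (subIoo L a b) univ := by
  obtain ⟨n, j, a', b', ha', haφ, hbφ, hb', hreach⟩ := h.exists_reach_foot ha hab hb
  -- The foot is sent to the vertex `j + 2`, so the part left of it lands on an interval starting at
  -- that vertex.
  have h1 := h.reach_left ha' haφ (h.foot_lt hc j).le le_rfl
  rw [mul_div_cancel_right₀ _ (hc j).ne', sub_self] at h1
  have h2 : Reach F (n + 1) (subIoo L a b) (side σ L (j + 2) 0 (ℓ (j + 2) - a' / c j)) :=
    (hreach.mono h.measurable Subset.rfl (side_subset le_rfl hbφ.le)).trans h.measurable h1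
  obtain ⟨k, i, h3⟩ := h.exists_reach_side hc (j + 2) (η := ℓ (j + 2) - a' / c j) (by
    rw [sub_pos, div_lt_iff₀ (hc j)]; exact haφ)
  exact ⟨n + 1 + k + 2, (h2.trans h.measurable h3).trans h.measurable (h.reach_univ_of_side hc i)⟩

end Acute

/-! ### Right and obtuse triangles. -/

section NotAcute

theorem foot_nonpos (h : IsTriangleSlap ℓ c σ L F) {k : Fin 3} (hk : c k ≤ 0) :
    ℓ (k + 2) * c k ≤ 0 :=
  mul_nonpos_of_nonneg_of_nonpos (h.pos _).le hk

/-- The side `k + 2` ends at the vertex `k`; with a nonacute angle there, the altitude falls at or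
beyond this end. -/
theorem le_foot (h : IsTriangleSlap ℓ c σ L F) {k : Fin 3} (hk : c k ≤ 0) :
    ℓ (k + 2) ≤ ℓ (k + 2 + 2) * c (k + 2) := by
  have h1 := h.proj (k + 2)
  have e : k + 2 + 1 = k := by clear * -; revert k; decide
  rw [e] at h1
  nlinarith [h.pos k]

/-- The only foot interior to its side is the one opposite the nonacute vertex. Both intervals grow
until they contain it, and then they overlap. -/
theorem exists_reach_common (h : IsTriangleSlap ℓ c σ L F) {k : Fin 3} (hk : c k ≤ 0)
    {a b a' b' : ℝ} (ha : 0 ≤ a) (hab : a < b) (hb : b ≤ L) (ha' : 0 ≤ a') (hab' : a' < b')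
    (hb' : b' ≤ L) : ∃ n n' H, lebIcc L H ≠ 0 ∧ Reach F n (subIoo L a b) H ∧
      Reach F n' (subIoo L a' b') H := by
  have hside : ∀ {a b}, 0 ≤ a → a < b → b ≤ L → ∃ n u v, 0 ≤ u ∧
      u < ℓ (k + 1 + 2) * c (k + 1) ∧ ℓ (k + 1 + 2) * c (k + 1) < v ∧ v ≤ ℓ (k + 1) ∧
      Reach F n (subIoo L a b) (side σ L (k + 1) u v) := by
    intro a b ha hab hb
    obtain ⟨n, j, u, v, hu, huφ, hφv, hv, hreach⟩ := h.exists_reach_foot ha hab hb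
    have e : j = k ∨ j = k + 2 ∨ j = k + 1 := by clear * -; revert j k; decide
    rcases e with rfl | rfl | rfl
    · linarith [h.foot_nonpos hk]
    · linarith [h.le_foot hk]
    · exact ⟨n, u, v, hu, huφ, hφv, hv, hreach⟩
  obtain ⟨n, u, v, hu, huφ, hφv, hv, hr⟩ := hside ha hab hb
  obtain ⟨n', u', v', hu', huφ', hφv', hv', hr'⟩ := hside ha' hab' hb'
  refine ⟨n, n', side σ L (k + 1) (max u u') (min v v'), ?_,
    hr.mono h.measurable Subset.rfl (side_subset (le_max_left _ _) (min_le_left _ _)),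
    hr'.mono h.measurable Subset.rfl (side_subset (le_max_right _ _) (min_le_right _ _))⟩
  refine lebIcc_subIoo_ne_zero ?_ ?_ ?_
  · have := h.start_nonneg (k + 1)
    have := hu.trans (le_max_left u u')
    linarith
  · have := (max_lt huφ huφ').trans (lt_min hφv hφv')
    linarith
  · have := h.end_le (k + 1)
    have := (min_le_left v v').trans hv
    linarith

theorem map_mem_side_left (h : IsTriangleSlap ℓ c σ L F) {i : Fin 3} {x : Icc (0 : ℝ) L}
    (hx : (x : ℝ) ∈ Ioo (σ i) (σ i + ℓ i)) (hφ : x - σ i < ℓ (i + 2) * c i) :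
    (F x : ℝ) ∈ Ioo (σ (i + 2)) (σ (i + 2) + ℓ (i + 2)) := by
  have hc : 0 < c i := h.cos_pos_of_left (sub_pos.2 hx.1) hφ.le
  rw [h.left i x hx.1 hx.2 hφ]
  have h1 : (x - σ i) / c i < ℓ (i + 2) := (div_lt_iff₀ hc).2 hφ
  have h2 : 0 < (x - σ i) / c i := div_pos (sub_pos.2 hx.1) hc
  constructor <;> linarith

theorem map_mem_side_right (h : IsTriangleSlap ℓ c σ L F) {i : Fin 3} {x : Icc (0 : ℝ) L}
    (hx : (x : ℝ) ∈ Ioo (σ i) (σ i + ℓ i)) (hφ : ℓ (i + 2) * c i < x - σ i) :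
    (F x : ℝ) ∈ Ioo (σ (i + 1)) (σ (i + 1) + ℓ (i + 1)) := by
  have hc : 0 < c (i + 1) := h.cos_pos_of_right (t := x - σ i) (by linarith [hx.2]) hφ.le
  rw [h.right i x hx.1 hx.2 hφ]
  have h1 : (σ i + ℓ i - x) / c (i + 1) < ℓ (i + 1) :=
    (div_lt_iff₀ hc).2 (by linarith [h.proj i])
  have h2 : 0 < (σ i + ℓ i - x) / c (i + 1) := div_pos (by linarith [hx.2]) hc
  constructor <;> linarith

theorem ae_exists_side (h : IsTriangleSlap ℓ c σ L F) : ∀ᵐ x : Icc (0 : ℝ) L ∂lebIcc L,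
    ∃ i, (x : ℝ) ∈ Ioo (σ i) (σ i + ℓ i) ∧ (x : ℝ) - σ i ≠ ℓ (i + 2) * c i :=
  (h.finite_compl_sides fun i => ℓ (i + 2) * c i).measure_zero _

/-- If the angle at the vertex `k` is not acute, the opposite side and the union of the other two
sides are exchanged. -/
theorem preimage_side_ae_eq_compl (h : IsTriangleSlap ℓ c σ L F) {k : Fin 3} (hk : c k ≤ 0) :
    F ⁻¹' side σ L (k + 1) 0 (ℓ (k + 1)) =ᵐ[lebIcc L]
      (side σ L (k + 1) 0 (ℓ (k + 1)))ᶜ := by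
  have hmem : ∀ x : Icc (0 : ℝ) L, x ∈ side σ L (k + 1) 0 (ℓ (k + 1)) ↔
      (x : ℝ) ∈ Ioo (σ (k + 1)) (σ (k + 1) + ℓ (k + 1)) := fun x => by
    rw [side, mem_subIoo, add_zero]; rfl
  filter_upwards [h.ae_exists_side] with x hx
  obtain ⟨i, hx, hφ⟩ := hx
  refine propext ?_
  change F x ∈ side σ L (k + 1) 0 (ℓ (k + 1)) ↔ ¬ x ∈ side σ L (k + 1) 0 (ℓ (k + 1))
  rw [hmem, hmem]
  have e : i = k ∨ i = k + 2 ∨ i = k + 1 := by clear * -; revert i k; decide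
  rcases e with rfl | rfl | rfl
  · have h1 := h.map_mem_side_right hx (by linarith [h.foot_nonpos hk, hx.1])
    exact iff_of_true h1 fun h2 => absurd (h.side_unique hx h2) (by clear * -; revert i; decide)
  · have h1 := h.map_mem_side_left hx (by linarith [h.le_foot hk, hx.2])
    rw [show k + 2 + 2 = k + 1 by clear * -; revert k; decide] at h1
    exact iff_of_true h1 fun h2 => absurd (h.side_unique hx h2) (by clear * -; revert k; decide)
  · refine iff_of_false (fun h1 => ?_) (not_not.2 hx)
    rcases lt_or_gt_of_ne hφ with h2 | h2
    · exact absurd (h.side_unique h1 (h.map_mem_side_left hx h2)) (by clear * -; revert k; decide)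
    · exact absurd (h.side_unique h1 (h.map_mem_side_right hx h2)) (by clear * -; revert k; decide)

end NotAcute

end IsTriangleSlap

end TriangleSlap

/-! ### Geometry: the slap map has the normal form. -/

section SlapMap

open scoped ENNReal

theorem measurable_of_eqOn_of_countable {L : ℝ} {F : Icc (0 : ℝ) L → Icc (0 : ℝ) L} {ι : Type*}
    [Countable ι] (I : ι → Set (Icc (0 : ℝ) L)) (a : ι → ℝ → ℝ) (hI : ∀ k, MeasurableSet (I k))
    (ha : ∀ k, Measurable (a k)) (hFa : ∀ k, ∀ x ∈ I k, (F x : ℝ) = a k x)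
    (hc : (⋃ k, I k)ᶜ.Countable) : Measurable F := by
  refine Measurable.subtype_mk (p := fun x : ℝ => x ∈ Icc 0 L) (f := fun x => (F x : ℝ))
    (h := fun x => (F x).2) ?_
  intro E hE
  have h1 : (fun x => (F x : ℝ)) ⁻¹' E =
      (⋃ k, I k ∩ {x : Icc (0 : ℝ) L | a k x ∈ E}) ∪
        ((fun x => (F x : ℝ)) ⁻¹' E ∩ (⋃ k, I k)ᶜ) := by
    ext x
    simp only [mem_preimage, mem_union, mem_iUnion, mem_inter_iff, mem_compl_iff, mem_ofPred_eq]
    constructor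
    · intro hx
      by_cases h : ∃ k, x ∈ I k
      · obtain ⟨k, hk⟩ := h
        exact Or.inl ⟨k, hk, by rwa [← hFa k x hk]⟩
      · exact Or.inr ⟨hx, h⟩
    · rintro (⟨k, hk, hx⟩ | ⟨hx, -⟩)
      · rwa [hFa k x hk]
      · exact hx
  rw [h1]
  refine (MeasurableSet.iUnion fun k => (hI k).inter ?_).union
    (hc.mono inter_subset_right).measurableSet
  exact ((ha k).comp measurable_subtype_coe) hE

namespace Slap

/-- The cosine of the angle at the vertex `i`. -/
noncomputable def vertexCos (T : Affine.Triangle ℝ Plane) (i : Fin 3) : ℝ :=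
  Real.cos (EuclideanGeometry.angle (T.points (i + 1)) (T.points i) (T.points (i + 2)))

variable (T : Affine.Triangle ℝ Plane)

theorem sideLength_pos (i : Fin 3) : 0 < sideLength T i :=
  dist_pos.2 (T.independent.injective.ne (by revert i; decide))

theorem isSideDecomposition : IsSideDecomposition (sideLength T) (sideStart T) (perimeter T) where
  pos := sideLength_pos T
  start_zero := by
    rw [sideStart, show Finset.Iio (0 : Fin 3) = ∅ by decide, Finset.sum_empty]
  start_one := by
    rw [sideStart, show Finset.Iio (1 : Fin 3) = {0} by decide, Finset.sum_singleton]
  start_two := by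
    rw [sideStart, show Finset.Iio (2 : Fin 3) = {0, 1} by decide,
      Finset.sum_pair (by decide)]
  length_eq := Fin.sum_univ_three _

theorem norm_side (i : Fin 3) : ‖T.points (i + 1) - T.points i‖ = sideLength T i := by
  rw [sideLength, dist_comm, dist_eq_norm]

theorem norm_side_add_two (i : Fin 3) : ‖T.points (i + 2) - T.points i‖ = sideLength T (i + 2) := by
  rw [sideLength, dist_eq_norm, show i + 2 + 1 = i by revert i; decide]

theorem inner_side (i : Fin 3) :
    inner ℝ (T.points (i + 1) - T.points i) (T.points (i + 2) - T.points i) =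
      vertexCos T i * (sideLength T i * sideLength T (i + 2)) := by
  rw [← norm_side, ← norm_side_add_two]
  exact (InnerProductGeometry.cos_angle_mul_norm_mul_norm _ _).symm

theorem inner_side_self (i : Fin 3) :
    inner ℝ (T.points (i + 1) - T.points i) (T.points (i + 1) - T.points i) =
      sideLength T i * sideLength T i := by
  rw [real_inner_self_eq_norm_mul_norm, norm_side]

theorem inner_side_add_two_self (i : Fin 3) :
    inner ℝ (T.points (i + 2) - T.points i) (T.points (i + 2) - T.points i) =
      sideLength T (i + 2) * sideLength T (i + 2) := by
  rw [real_inner_self_eq_norm_mul_norm, norm_side_add_two]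

theorem abs_vertexCos_lt_one (i : Fin 3) : |vertexCos T i| < 1 := by
  have hnc := (affineIndependent_iff_not_collinear_of_ne (k := ℝ) (p := T.points)
    (i₁ := i + 1) (i₂ := i) (i₃ := i + 2) (by revert i; decide) (by revert i; decide)
    (by revert i; decide)).1 T.independent
  have hsin := EuclideanGeometry.sin_pos_of_not_collinear hnc
  rw [← sq_lt_one_iff_abs_lt_one, vertexCos]
  nlinarith [Real.sin_sq_add_cos_sq
    (EuclideanGeometry.angle (T.points (i + 1)) (T.points i) (T.points (i + 2)))]

theorem sideLength_eq (i : Fin 3) : sideLength T i =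
    sideLength T (i + 2) * vertexCos T i + sideLength T (i + 1) * vertexCos T (i + 1) := by
  have h1 := inner_side T i
  have h2 := inner_side T (i + 1)
  have h3 := inner_side_self T i
  rw [show i + 1 + 1 = i + 2 by clear * -; revert i; decide, show i + 1 + 2 = i by clear * -; revert i; decide] at h2
  have h4 : inner ℝ (T.points (i + 2) - T.points (i + 1)) (T.points i - T.points (i + 1)) =
      inner ℝ (T.points (i + 1) - T.points i) (T.points (i + 1) - T.points i) -
      inner ℝ (T.points (i + 1) - T.points i) (T.points (i + 2) - T.points i) := by
    rw [← inner_sub_right, real_inner_comm, ← neg_sub (T.points (i + 1)) (T.points i),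
      inner_neg_left, ← inner_neg_right]
    congr 1
    abel
  rw [h4, h3, h1] at h2
  refine mul_left_cancel₀ (sideLength_pos T i).ne' ?_
  linarith

theorem inner_side_add_one (i : Fin 3) :
    inner ℝ (T.points (i + 2) - T.points (i + 1)) (T.points (i + 1) - T.points i) =
      -(vertexCos T (i + 1) * (sideLength T i * sideLength T (i + 1))) := by
  have h1 := inner_side T (i + 1)
  rw [show i + 1 + 1 = i + 2 by clear * -; revert i; decide, show i + 1 + 2 = i by clear * -; revert i; decide] at h1
  rw [← neg_sub (T.points i), inner_neg_right, h1]
  ring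

theorem inner_side_add_one_self (i : Fin 3) :
    inner ℝ (T.points (i + 2) - T.points (i + 1)) (T.points (i + 2) - T.points (i + 1)) =
      sideLength T (i + 1) * sideLength T (i + 1) := by
  have h1 := inner_side_self T (i + 1)
  rwa [show i + 1 + 1 = i + 2 by clear * -; revert i; decide] at h1

theorem boundaryPoint_eq {i : Fin 3} {s : ℝ}
    (hs : s ∈ Ioo (sideStart T i) (sideStart T i + sideLength T i)) :
    boundaryPoint T s = sidePoint T i (s - sideStart T i) := by
  have h := isSideDecomposition T
  have h0 := h.start_zero
  have h1 := h.start_one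
  have h2 := h.start_two
  have p0 := h.pos 0
  have p1 := h.pos 1
  obtain ⟨a, b⟩ := hs
  rw [boundaryPoint]
  fin_cases i <;> simp only [Fin.zero_eta, Fin.mk_one, Fin.reduceFinMk] at *
  · rw [if_pos (by linarith), h0, sub_zero]
  · rw [if_neg (by linarith), if_pos (by linarith)]
  · rw [if_neg (by linarith), if_neg (by linarith)]

theorem exists_boundaryPoint_eq (r : Param T) : ∃ j, ∃ u : ℝ, 0 ≤ u ∧ u ≤ sideLength T j ∧
    (r : ℝ) = sideStart T j + u ∧ boundaryPoint T r = sidePoint T j u := by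
  have h := isSideDecomposition T
  have h0 := h.start_zero
  have h1 := h.start_one
  have h2 := h.start_two
  have hL := h.length_eq
  have hr := r.2
  rw [boundaryPoint]
  split_ifs with c1 c2
  · exact ⟨0, r, hr.1, by linarith, by linarith, rfl⟩
  · exact ⟨1, r - sideStart T 1, by linarith, by linarith, by linarith, rfl⟩
  · exact ⟨2, r - sideStart T 2, by linarith, by linarith [hr.2], by linarith, rfl⟩

theorem sidePoint_eq (i : Fin 3) (t : ℝ) : sidePoint T i t =
    (t / sideLength T i) • (T.points (i + 1) - T.points i) + T.points i := by
  rw [sidePoint, AffineMap.lineMap_apply]; rfl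

theorem sidePoint_add_one_sub (i : Fin 3) (t u : ℝ) :
    sidePoint T (i + 1) u - sidePoint T i t =
      (1 - t / sideLength T i) • (T.points (i + 1) - T.points i) +
        (u / sideLength T (i + 1)) • (T.points (i + 2) - T.points (i + 1)) := by
  rw [sidePoint_eq, sidePoint_eq, show i + 1 + 1 = i + 2 by clear * -; revert i; decide]
  module

theorem sidePoint_add_two_sub (i : Fin 3) (t u : ℝ) :
    sidePoint T (i + 2) u - sidePoint T i t =
      (1 - u / sideLength T (i + 2)) • (T.points (i + 2) - T.points i) -
        (t / sideLength T i) • (T.points (i + 1) - T.points i) := by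
  rw [sidePoint_eq, sidePoint_eq, show i + 2 + 1 = i by clear * -; revert i; decide]
  module

theorem sidePoint_notMem_inwardRay (i : Fin 3) (t u : ℝ) :
    sidePoint T i u ∉ inwardRay T i (sidePoint T i t) := by
  rintro ⟨h1, h2⟩
  have hℓ := sideLength_pos T i
  have e : sidePoint T i u - sidePoint T i t =
      (u / sideLength T i - t / sideLength T i) • (T.points (i + 1) - T.points i) := by
    rw [sidePoint_eq, sidePoint_eq]
    module
  rw [e, inner_smul_left, inner_side_self] at h1
  rcases mul_eq_zero.1 h1 with h | h
  · rw [e, inner_smul_left, h, zero_mul] at h2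
    exact h2.false
  · exact (mul_pos hℓ hℓ).ne' h

theorem inner_sidePoint_add_one_sub (i : Fin 3) (t u : ℝ) :
    inner ℝ (sidePoint T (i + 1) u - sidePoint T i t) (T.points (i + 1) - T.points i) =
      sideLength T i * (sideLength T i - t - u * vertexCos T (i + 1)) := by
  have h1 := (sideLength_pos T i).ne'
  have h2 := (sideLength_pos T (i + 1)).ne'
  rw [sidePoint_add_one_sub, inner_add_left, inner_smul_left, inner_smul_left, inner_side_self,
    inner_side_add_one]
  simp only [conj_trivial]
  field_simp
  ring

theorem inner_sidePoint_add_two_sub (i : Fin 3) (t u : ℝ) :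
    inner ℝ (sidePoint T (i + 2) u - sidePoint T i t) (T.points (i + 1) - T.points i) =
      sideLength T i * ((sideLength T (i + 2) - u) * vertexCos T i - t) := by
  have h1 := (sideLength_pos T i).ne'
  have h2 := (sideLength_pos T (i + 2)).ne'
  rw [sidePoint_add_two_sub, inner_sub_left, inner_smul_left, inner_smul_left, inner_side_self,
    real_inner_comm, inner_side]
  simp only [conj_trivial]
  field_simp

theorem sidePoint_add_two_mem_inwardRay {i : Fin 3} {t : ℝ} (ht : 0 < t) (hc : 0 < vertexCos T i) :
    sidePoint T (i + 2) (sideLength T (i + 2) - t / vertexCos T i) ∈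
      inwardRay T i (sidePoint T i t) := by
  have h1 := sideLength_pos T i
  have h2 := sideLength_pos T (i + 2)
  refine ⟨?_, ?_⟩
  · rw [inner_sidePoint_add_two_sub, sub_sub_cancel, div_mul_cancel₀ _ hc.ne', sub_self, mul_zero]
  · rw [sidePoint_add_two_sub, inner_sub_left, inner_smul_left, inner_smul_left,
      inner_side_add_two_self, inner_side]
    simp only [conj_trivial]
    have hc1 : vertexCos T i < 1 := (le_abs_self _).trans_lt (abs_vertexCos_lt_one T i)
    have e : (1 - (sideLength T (i + 2) - t / vertexCos T i) / sideLength T (i + 2)) *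
          (sideLength T (i + 2) * sideLength T (i + 2)) -
        t / sideLength T i * (vertexCos T i * (sideLength T i * sideLength T (i + 2))) =
        sideLength T (i + 2) * (t / vertexCos T i) * ((1 - vertexCos T i) * (1 + vertexCos T i)) := by
      field_simp
      ring
    rw [e]
    have : 0 < 1 - vertexCos T i := sub_pos.2 hc1
    positivity

theorem sidePoint_add_one_mem_inwardRay {i : Fin 3} {t : ℝ} (ht : t < sideLength T i)
    (hc : 0 < vertexCos T (i + 1)) :
    sidePoint T (i + 1) ((sideLength T i - t) / vertexCos T (i + 1)) ∈
      inwardRay T i (sidePoint T i t) := by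
  have h1 := sideLength_pos T i
  have h2 := sideLength_pos T (i + 1)
  have h3 : inner ℝ (sidePoint T (i + 1) ((sideLength T i - t) / vertexCos T (i + 1)) -
      sidePoint T i t) (T.points (i + 1) - T.points i) = 0 := by
    rw [inner_sidePoint_add_one_sub, div_mul_cancel₀ _ hc.ne', sub_self, mul_zero]
  refine ⟨h3, ?_⟩
  rw [show T.points (i + 2) - T.points i =
    (T.points (i + 2) - T.points (i + 1)) + (T.points (i + 1) - T.points i) by abel,
    inner_add_right, h3, add_zero, sidePoint_add_one_sub, inner_add_left, inner_smul_left,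
    inner_smul_left, inner_side_add_one_self, real_inner_comm, inner_side_add_one]
  simp only [conj_trivial]
  have hc1 : vertexCos T (i + 1) < 1 := (le_abs_self _).trans_lt (abs_vertexCos_lt_one T (i + 1))
  have e : (1 - t / sideLength T i) *
        -(vertexCos T (i + 1) * (sideLength T i * sideLength T (i + 1))) +
      (sideLength T i - t) / vertexCos T (i + 1) / sideLength T (i + 1) *
        (sideLength T (i + 1) * sideLength T (i + 1)) =
      sideLength T (i + 1) * ((sideLength T i - t) / vertexCos T (i + 1)) *
        ((1 - vertexCos T (i + 1)) * (1 + vertexCos T (i + 1))) := by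
    field_simp
    ring
  rw [e]
  have h4 : 0 < 1 - vertexCos T (i + 1) := sub_pos.2 hc1
  have h5 : 0 < sideLength T i - t := sub_pos.2 ht
  positivity

/-- When only one parameter lies on the ray, minimality of the distance is automatic and the choice
in `slapMap` is forced. -/
theorem slapMap_eq {s r : Param T} {i : Fin 3}
    (hs : (s : ℝ) ∈ Ioo (sideStart T i) (sideStart T i + sideLength T i))
    (hmem : boundaryPoint T r ∈ inwardRay T i (boundaryPoint T s))
    (huniq : ∀ r' : Param T, boundaryPoint T r' ∈ inwardRay T i (boundaryPoint T s) → r' = r) :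
    slapMap T s = r := by
  have hex : ∃ s', SlapsTo T s s' := ⟨r, i, hs, hmem, fun r' hr' => by rw [huniq r' hr']⟩
  rw [slapMap, dif_pos hex]
  obtain ⟨j, hj, hmem', -⟩ := hex.choose_spec
  rw [← (isSideDecomposition T).side_unique hs hj] at hmem'
  exact huniq _ hmem'

/-- Orthogonality alone fixes the position on each of the other two sides; the side `i` itself meets
its normal line only at the starting point, which the open ray omits. -/
theorem eq_of_mem_inwardRay {i : Fin 3} {t : ℝ} {r : Param T}
    (hr : boundaryPoint T r ∈ inwardRay T i (sidePoint T i t)) :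
    (∃ u, 0 ≤ u ∧ u ≤ sideLength T (i + 1) ∧ (r : ℝ) = sideStart T (i + 1) + u ∧
      u * vertexCos T (i + 1) = sideLength T i - t) ∨
    (∃ u, 0 ≤ u ∧ u ≤ sideLength T (i + 2) ∧ (r : ℝ) = sideStart T (i + 2) + u ∧
      (sideLength T (i + 2) - u) * vertexCos T i = t) := by
  obtain ⟨j, u, hu0, hu, hru, hb⟩ := exists_boundaryPoint_eq T r
  rw [hb] at hr
  have hℓ := (sideLength_pos T i).ne'
  have e : j = i ∨ j = i + 1 ∨ j = i + 2 := by clear * -; revert i j; decide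
  rcases e with rfl | rfl | rfl
  · exact absurd hr (sidePoint_notMem_inwardRay T j t u)
  · have h1 := hr.1
    rw [inner_sidePoint_add_one_sub] at h1
    have h2 := (mul_eq_zero.1 h1).resolve_left hℓ
    exact Or.inl ⟨u, hu0, hu, hru, by linarith⟩
  · have h1 := hr.1
    rw [inner_sidePoint_add_two_sub] at h1
    have h2 := (mul_eq_zero.1 h1).resolve_left hℓ
    exact Or.inr ⟨u, hu0, hu, hru, by linarith⟩

theorem slapMap_left (i : Fin 3) (x : Param T) (h1 : sideStart T i < x)
    (h2 : x < sideStart T i + sideLength T i)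
    (hφ : x - sideStart T i < sideLength T (i + 2) * vertexCos T i) :
    (slapMap T x : ℝ) = sideStart T (i + 2) + sideLength T (i + 2) -
      (x - sideStart T i) / vertexCos T i := by
  have hd := isSideDecomposition T
  have ht : 0 < (x : ℝ) - sideStart T i := sub_pos.2 h1
  have hc : 0 < vertexCos T i := pos_of_mul_pos_right (ht.trans hφ) (hd.pos _).le
  have hv0 : 0 < (x - sideStart T i) / vertexCos T i := div_pos ht hc
  have hv1 : (x - sideStart T i) / vertexCos T i < sideLength T (i + 2) := (div_lt_iff₀ hc).2 hφ
  have hr : sideStart T (i + 2) + sideLength T (i + 2) - (x - sideStart T i) / vertexCos T i ∈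
      Ioo (sideStart T (i + 2)) (sideStart T (i + 2) + sideLength T (i + 2)) :=
    ⟨by linarith, by linarith⟩
  have hrL : sideStart T (i + 2) + sideLength T (i + 2) - (x - sideStart T i) / vertexCos T i ∈
      Icc 0 (perimeter T) :=
    ⟨(hd.start_nonneg _).trans hr.1.le, hr.2.le.trans (hd.end_le _)⟩
  have key : slapMap T x = ⟨_, hrL⟩ := by
    refine slapMap_eq T (i := i) ⟨h1, h2⟩ ?_ fun r' hr' => ?_
    · rw [boundaryPoint_eq T (i := i) ⟨h1, h2⟩, boundaryPoint_eq T hr]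
      have := sidePoint_add_two_mem_inwardRay T ht hc
      convert this using 2
      ring
    · rw [boundaryPoint_eq T (i := i) ⟨h1, h2⟩] at hr'
      rcases eq_of_mem_inwardRay T hr' with ⟨u, hu0, hu, hru, hcu⟩ | ⟨u, hu0, hu, hru, hcu⟩
      -- Hitting the side `i + 1` would put the starting point at or beyond the foot of the
      -- altitude.
      · exfalso
        have hproj := sideLength_eq T i
        have hc' : 0 < vertexCos T (i + 1) :=
          pos_of_mul_pos_right (a := u) (by linarith) hu0
        nlinarith [mul_le_mul_of_nonneg_right hu hc'.le]
      · refine Subtype.ext ?_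
        change (r' : ℝ) = sideStart T (i + 2) + sideLength T (i + 2) -
          (x - sideStart T i) / vertexCos T i
        rw [hru, ← eq_div_of_mul_eq hc.ne' hcu]
        ring
  rw [key]

theorem slapMap_right (i : Fin 3) (x : Param T) (h1 : sideStart T i < x)
    (h2 : x < sideStart T i + sideLength T i)
    (hφ : sideLength T (i + 2) * vertexCos T i < x - sideStart T i) :
    (slapMap T x : ℝ) = sideStart T (i + 1) +
      (sideStart T i + sideLength T i - x) / vertexCos T (i + 1) := by
  have hd := isSideDecomposition T
  have hproj := sideLength_eq T i
  have ht : 0 < sideStart T i + sideLength T i - (x : ℝ) := sub_pos.2 h2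
  have hφ' : sideStart T i + sideLength T i - (x : ℝ) <
      sideLength T (i + 1) * vertexCos T (i + 1) := by linarith
  have hc : 0 < vertexCos T (i + 1) := pos_of_mul_pos_right (ht.trans hφ') (hd.pos _).le
  have hv0 : 0 < (sideStart T i + sideLength T i - x) / vertexCos T (i + 1) := div_pos ht hc
  have hv1 : (sideStart T i + sideLength T i - x) / vertexCos T (i + 1) < sideLength T (i + 1) :=
    (div_lt_iff₀ hc).2 hφ'
  have hr : sideStart T (i + 1) + (sideStart T i + sideLength T i - x) / vertexCos T (i + 1) ∈
      Ioo (sideStart T (i + 1)) (sideStart T (i + 1) + sideLength T (i + 1)) :=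
    ⟨by linarith, by linarith⟩
  have hrL : sideStart T (i + 1) + (sideStart T i + sideLength T i - x) / vertexCos T (i + 1) ∈
      Icc 0 (perimeter T) :=
    ⟨(hd.start_nonneg _).trans hr.1.le, hr.2.le.trans (hd.end_le _)⟩
  have key : slapMap T x = ⟨_, hrL⟩ := by
    refine slapMap_eq T (i := i) ⟨h1, h2⟩ ?_ fun r' hr' => ?_
    · rw [boundaryPoint_eq T (i := i) ⟨h1, h2⟩, boundaryPoint_eq T hr]
      have := sidePoint_add_one_mem_inwardRay T (i := i) (t := x - sideStart T i) (by linarith) hc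
      convert this using 2
      ring
    · rw [boundaryPoint_eq T (i := i) ⟨h1, h2⟩] at hr'
      rcases eq_of_mem_inwardRay T hr' with ⟨u, hu0, hu, hru, hcu⟩ | ⟨u, hu0, hu, hru, hcu⟩
      · refine Subtype.ext ?_
        rw [hru, eq_div_of_mul_eq hc.ne' hcu]
        change _ = sideStart T (i + 1) + _
        ring
      · exfalso
        have hc' : 0 < vertexCos T i :=
          pos_of_mul_pos_right (a := sideLength T (i + 2) - u) (by linarith) (by linarith)
        nlinarith [mul_nonneg hu0 hc'.le]
  rw [key]

theorem measurable_slapMap : Measurable (slapMap T) := by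
  let I : Fin 3 ⊕ Fin 3 → Set (Param T) := Sum.elim
    (fun i => {x | (x : ℝ) ∈ Ioo (sideStart T i) (sideStart T i + sideLength T i) ∧
      (x : ℝ) - sideStart T i < sideLength T (i + 2) * vertexCos T i})
    (fun i => {x | (x : ℝ) ∈ Ioo (sideStart T i) (sideStart T i + sideLength T i) ∧
      sideLength T (i + 2) * vertexCos T i < (x : ℝ) - sideStart T i})
  let a : Fin 3 ⊕ Fin 3 → ℝ → ℝ := Sum.elim
    (fun i x => sideStart T (i + 2) + sideLength T (i + 2) - (x - sideStart T i) / vertexCos T i)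
    (fun i x => sideStart T (i + 1) +
      (sideStart T i + sideLength T i - x) / vertexCos T (i + 1))
  refine measurable_of_eqOn_of_countable I a ?_ ?_ ?_ ?_
  · rintro (i | i)
    · exact (measurable_subtype_coe measurableSet_Ioo).inter
        (measurableSet_lt (measurable_subtype_coe.sub_const _) measurable_const)
    · exact (measurable_subtype_coe measurableSet_Ioo).inter
        (measurableSet_lt measurable_const (measurable_subtype_coe.sub_const _))
  · rintro (i | i) <;> simp only [a, Sum.elim_inl, Sum.elim_inr] <;> fun_prop
  · rintro (i | i) x hx
    · exact slapMap_left T i x hx.1.1 hx.1.2 hx.2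
    · exact slapMap_right T i x hx.1.1 hx.1.2 hx.2
  · refine (((isSideDecomposition T).finite_compl_sides
      fun i => sideLength T (i + 2) * vertexCos T i).subset fun x hx => ?_).countable
    rintro ⟨i, hi, hne⟩
    refine hx (mem_iUnion.2 ?_)
    rcases lt_or_gt_of_ne hne with h | h
    · exact ⟨Sum.inl i, hi, h⟩
    · exact ⟨Sum.inr i, hi, h⟩

theorem isTriangleSlap : IsTriangleSlap (sideLength T) (vertexCos T) (sideStart T) (perimeter T)
    (slapMap T) where
  toIsSideDecomposition := isSideDecomposition T
  measurable := measurable_slapMap T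
  abs_lt := abs_vertexCos_lt_one T
  proj := sideLength_eq T
  left := slapMap_left T
  right := slapMap_right T

theorem acuteAngled_iff : T.AcuteAngled ↔ ∀ i, 0 < vertexCos T i := by
  have hcos : ∀ i, 0 < vertexCos T i ↔ EuclideanGeometry.angle (T.points (i + 1)) (T.points i)
      (T.points (i + 2)) < Real.pi / 2 := fun i => by
    have h0 := EuclideanGeometry.angle_nonneg (T.points (i + 1)) (T.points i) (T.points (i + 2))
    have hpi := EuclideanGeometry.angle_le_pi (T.points (i + 1)) (T.points i) (T.points (i + 2))
    constructor
    · intro h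
      by_contra h'
      exact absurd h (not_lt.2 (Real.cos_nonpos_of_pi_div_two_le_of_le (not_lt.1 h')
        (by linarith [Real.pi_pos])))
    · intro h
      exact Real.cos_pos_of_mem_Ioo ⟨by linarith [Real.pi_pos], h⟩
  simp_rw [hcos]
  constructor
  · intro h i
    exact h _ _ _ (by clear * -; revert i; decide) (by clear * -; revert i; decide) (by clear * -; revert i; decide)
  · intro h i₁ i₂ i₃ h₁₂ h₁₃ h₂₃
    have e : (i₁ = i₂ + 1 ∧ i₃ = i₂ + 2) ∨ (i₁ = i₂ + 2 ∧ i₃ = i₂ + 1) := by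
      clear * - h₁₂ h₁₃ h₂₃; revert i₁ i₂ i₃; decide
    rcases e with ⟨rfl, rfl⟩ | ⟨rfl, rfl⟩
    · exact h i₂
    · rw [EuclideanGeometry.angle_comm]
      exact h i₂

end Slap

end SlapMap

/-! ### Assembly of the theorem. -/

theorem theorem2 (T : Affine.Triangle ℝ Plane) :
    ∃ μ : Measure (Slap.Param T),
      -- `μ` is an ergodic acip of the slap map, and the only one
      IsAcip (Slap.lebesgue T) (Slap.slapMap T) μ ∧ Ergodic (Slap.slapMap T) μ ∧
      (∀ ν : Measure (Slap.Param T),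
        IsAcip (Slap.lebesgue T) (Slap.slapMap T) ν → Ergodic (Slap.slapMap T) ν → ν = μ) ∧
      -- acute triangles: mixing, with full support
      (T.AcuteAngled → IsMixing (Slap.slapMap T) μ ∧ μ.support = Set.univ) ∧
      -- other triangles: the number of mixing components exists and is even
      (¬ T.AcuteAngled →
        (∃ k : ℕ, HasMixingComponents (Slap.slapMap T) μ k) ∧
        ∀ k : ℕ, HasMixingComponents (Slap.slapMap T) μ k → Even k) := by
  have hT := Slap.isTriangleSlap T
  have hF : Measurable (Slap.slapMap T) := hT.measurable
  have hL : 0 < Slap.perimeter T := hT.length_pos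
  obtain ⟨Λ, hΛ, hΛc⟩ := hT.exists_slope
  have hP := hT.piecewiseExpanding hΛc
  obtain ⟨G, hG⟩ := hP.exists_isCellFamily hF hΛ hL
  obtain ⟨C, hC, hle⟩ := hP.map_iterate_le hF hΛ hL
  have hne : lebIcc (Slap.perimeter T) ≠ 0 := fun h0 => by
    have := lebIcc_univ (Slap.perimeter T)
    rw [h0, Measure.coe_zero, Pi.zero_apply] at this
    exact hL.not_ge (ENNReal.ofReal_eq_zero.1 this.symm)
  obtain ⟨μ, C', hC', hμp, hμle, hμF⟩ := exists_invariant_of_map_iterate_le _ hne hF hC hle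
  have hac : μ ≪ lebIcc (Slap.perimeter T) := (Measure.absolutelyContinuous_of_le hμle).trans
    (Measure.AbsolutelyContinuous.smul_left Measure.AbsolutelyContinuous.rfl C')
  have hacip : IsAcip (Slap.lebesgue T) (Slap.slapMap T) μ := ⟨hμp, hac, hμF⟩
  have hreach : T.AcuteAngled → ∀ a b, 0 ≤ a → a < b → b ≤ Slap.perimeter T →
      ∃ n, Reach (Slap.slapMap T) n (subIoo (Slap.perimeter T) a b) univ :=
    fun hacute a b ha hab hb => hT.exists_reach_univ ((Slap.acuteAngled_iff T).1 hacute) ha hab hb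
  have hmeet : ∀ a b a' b', 0 ≤ a → a < b → b ≤ Slap.perimeter T → 0 ≤ a' → a' < b' →
      b' ≤ Slap.perimeter T → ∃ n n' H, lebIcc (Slap.perimeter T) H ≠ 0 ∧
        Reach (Slap.slapMap T) n (subIoo (Slap.perimeter T) a b) H ∧
        Reach (Slap.slapMap T) n' (subIoo (Slap.perimeter T) a' b') H := by
    intro a b a' b' ha hab hb ha' hab' hb'
    by_cases hacute : T.AcuteAngled
    · obtain ⟨n, hn⟩ := hreach hacute a b ha hab hb
      obtain ⟨n', hn'⟩ := hreach hacute a' b' ha' hab' hb'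
      exact ⟨n, n', univ, by simpa using hne, hn, hn'⟩
    · rw [Slap.acuteAngled_iff] at hacute
      push Not at hacute
      obtain ⟨k, hk⟩ := hacute
      exact hT.exists_reach_common hk ha hab hb ha' hab' hb'
  have herg := hG.lebIcc_eq_zero_or hF hmeet
  have hμe : Ergodic (Slap.slapMap T) μ := hacip.ergodic herg
  refine ⟨μ, hacip, hμe, fun ν hν _ => hacip.eq hν herg, fun hacute => ⟨?_, ?_⟩, fun hacute =>
    ⟨?_, fun k hk => ?_⟩⟩
  · exact isMixing_of_tail_trivial hμF (hG.tail_trivial hμF hC' hμle (hreach hacute))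
  · exact support_eq_univ_of_lebIcc_absolutelyContinuous hL
      (hG.lebIcc_absolutelyContinuous hμF hac (hreach hacute))
  · obtain ⟨δ, hδ, htail⟩ := hG.exists_tail_bound hμF hC' hμle
    exact exists_hasMixingComponents hμe hδ htail
  · rw [Slap.acuteAngled_iff] at hacute
    push Not at hacute
    obtain ⟨j, hj⟩ := hacute
    exact hk.even_of_preimage_ae_eq_compl hμF (measurableSet_subIoo _ _ _)
      (hac.ae_le (hT.preimage_side_ae_eq_compl hj))
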